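/- Let $p>1$, $p'=p/(p-1)$, and let $a$ be a measurable function on $\mathbb R^d$ with $a>0$ a.e. and $$\|a\|_{p,w}:=\Big(\sup_{\tau>0}\tau^p\,\big|\{|a|>\tau\}\big|\Big)^{1/p}<\infty .$$ Let $a(-i\nabla)$ be the non-negative self-adjoint operator on $L_2(\mathbb R^d)$ that acts as multiplication by $a(\xi)$ in Fourier space, $\widehat{a(-i\nabla)f}(\xi)=a(\xi)\hat f(\xi)$ with $\hat f(\xi)=(2\pi)^{-d/2}\int e^{-i\xi\cdot x}f(x)\,dx$. Let $\gamma$ be a (possibly unbounded) self-adjoint operator on $L_2(\mathbb R^d)$ with $0\le\gamma\le a(-i\nabla)$ in the sense of quadratic forms, i.e. the domain of $a(-i\nabla)^{1/2}$ is contained in that of $\gamma^{1/2}$ and $\|\gamma^{1/2}f\|\le\|a(-i\nabla)^{1/2}f\|$ there. Write $$\operatorname{tr}\gamma^{1/2}a(-i\nabla)^{-1}\gamma^{1/2}\in[0,\infty]$$ for the trace of the quadratic form $f\mapsto\|a(-i\nabla)^{-1/2}\gamma^{1/2}f\|^2$ on the domain of $\gamma^{1/2}$, i.e. the supremum of its sums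 over finite orthonormal systems in that domain. The diagonal of $\gamma$ is the (a.e. unique) measurable function $x\mapsto\gamma(x,x)\in[0,\infty]$ such that $\int_\Omega\gamma(x,x)\,dx=\operatorname{tr}\chi_\Omega\gamma\chi_\Omega=\|\gamma^{1/2}\chi_\Omega\|_{HS}^2$ for every measurable set $\Omega$ of finite measure. If $\operatorname{tr}\gamma^{1/2}a(-i\nabla)^{-1}\gamma^{1/2}<\infty$, then the diagonal $\gamma(x,x)$ exists, is finite for a.e. $x$, and belongs to $L_{p'}(\mathbb R^d)$. Moreover, whenever the diagonal exists, $$\operatorname{tr}\gamma^{1/2}a(-i\nabla)^{-1}\gamma^{1/2}\ \ge\ \frac{p-1}{p+1}\,R^{sc}_{d,p}\,\|a\|_{p,w}^{-p'}\int_{\mathbb R^d}\gamma(x,x)^{p'}\,dx, \qquad R^{sc}_{d,p}=(2\pi)^{d/(p-1)}\Big(\frac{p-1}{p}\Big)^{p/(p-1)} .$$ -/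

import Mathlib

open MeasureTheory FourierTransform
open scoped ENNReal

noncomputable section

/-! ### Non-negative self-adjoint (possibly unbounded) operators and their square roots -/

section Operators

/-- `T` is a non-negative self-adjoint operator; it may be unbounded. (A self-adjoint partial linear
map is automatically densely defined.) -/
def IsPosSelfAdjoint {H : Type*} [NormedAddCommGroup H] [InnerProductSpace ℂ H] [CompleteSpace H]
    (T : H →ₗ.[ℂ] H) : Prop :=
  IsSelfAdjoint T ∧ ∀ x : T.domain, 0 ≤ (inner ℂ (x : H) (T x)).re

/-- `S` is a non-negative self-adjoint square root of `T`: one has `S ∘ S = T`, where the domain of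
`S ∘ S` consists of all `x` in the domain of `S` for which `S x` is in the domain of `S`. -/
def IsPosSqrt {H : Type*} [NormedAddCommGroup H] [InnerProductSpace ℂ H] [CompleteSpace H]
    (S T : H →ₗ.[ℂ] H) : Prop :=
  IsPosSelfAdjoint S ∧
    ∀ x z : H, (x, z) ∈ T.graph ↔ ∃ y : H, (x, y) ∈ S.graph ∧ (y, z) ∈ S.graph

theorem IsPosSelfAdjoint.symm_graph {H : Type*} [NormedAddCommGroup H] [InnerProductSpace ℂ H]
    [CompleteSpace H] {T : H →ₗ.[ℂ] H} (hT : IsPosSelfAdjoint T) {x z x' z' : H}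
    (h : (x, z) ∈ T.graph) (h' : (x', z') ∈ T.graph) : inner ℂ z x' = inner ℂ x z' := by
  have hd := hT.1.dense_domain
  have e : T.graph = T.graph.adjoint := by
    rw [← LinearPMap.adjoint_graph_eq_graph_adjoint hd, LinearPMap.isSelfAdjoint_def.mp hT.1]
  rw [e, Submodule.mem_adjoint_iff] at h'
  exact sub_eq_zero.mp (h' x z h)

theorem IsPosSelfAdjoint.pos_graph {H : Type*} [NormedAddCommGroup H] [InnerProductSpace ℂ H]
    [CompleteSpace H] {T : H →ₗ.[ℂ] H} (hT : IsPosSelfAdjoint T) {x z : H}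
    (h : (x, z) ∈ T.graph) : 0 ≤ (inner ℂ x z).re := by
  obtain ⟨y, rfl, rfl⟩ := (LinearPMap.mem_graph_iff T).mp h
  exact hT.2 y

/-- The resolvent `(1 + T)⁻¹` of a non-negative self-adjoint operator. -/
theorem IsPosSelfAdjoint.exists_resolvent {H : Type*} [NormedAddCommGroup H]
    [InnerProductSpace ℂ H] [CompleteSpace H] {T : H →ₗ.[ℂ] H} (hT : IsPosSelfAdjoint T) :
    ∃ R : H →L[ℂ] H, ∀ x z : H, (x, z) ∈ T.graph ↔ x = R (x + z) := by
  have hcl : IsClosed (T.graph : Set (H × H)) := hT.1.isClosed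
  have : CompleteSpace T.graph := hcl.completeSpace_coe
  let f : T.graph →L[ℂ] H :=
    (ContinuousLinearMap.fst ℂ H H + ContinuousLinearMap.snd ℂ H H).comp T.graph.subtypeL
  have hf : ∀ g : T.graph, f g = g.1.1 + g.1.2 := fun g => rfl
  have hanti : AntilipschitzWith 1 f := by
    refine f.antilipschitz_of_bound (K := 1) fun g => ?_
    have hp := hT.pos_graph (x := g.1.1) (z := g.1.2) g.2
    have hn : ‖f g‖ ^ 2 = ‖g.1.1‖ ^ 2 + 2 * (inner ℂ g.1.1 g.1.2).re + ‖g.1.2‖ ^ 2 := by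
      rw [hf]; exact norm_add_sq (𝕜 := ℂ) g.1.1 g.1.2
    have : ‖g‖ = max ‖g.1.1‖ ‖g.1.2‖ := rfl
    rw [this, NNReal.coe_one, one_mul]
    refine max_le ?_ ?_ <;> refine abs_le_of_sq_le_sq' ?_ (norm_nonneg _) |>.2 <;>
      nlinarith [sq_nonneg ‖g.1.1‖, sq_nonneg ‖g.1.2‖]
  have hker : LinearMap.ker (f : T.graph →ₗ[ℂ] H) = ⊥ := LinearMap.ker_eq_bot.mpr hanti.injective
  have hclr : IsClosed (Set.range f) := hanti.isClosed_range f.uniformContinuous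
  have hrange : LinearMap.range (f : T.graph →ₗ[ℂ] H) = ⊤ := by
    have : CompleteSpace (LinearMap.range (f : T.graph →ₗ[ℂ] H)) := by
      exact (show IsClosed ((LinearMap.range (f : T.graph →ₗ[ℂ] H) : Submodule ℂ H) : Set H) from
        hclr).completeSpace_coe
    rw [← Submodule.orthogonal_eq_bot_iff, Submodule.eq_bot_iff]
    intro y hy
    have key : (y, -y) ∈ T.graph := by
      have e : T.graph = T.graph.adjoint := by
        rw [← LinearPMap.adjoint_graph_eq_graph_adjoint hT.1.dense_domain,
          LinearPMap.isSelfAdjoint_def.mp hT.1]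
      rw [e, Submodule.mem_adjoint_iff]
      intro a b hab
      have := (Submodule.mem_orthogonal _ _).mp hy (a + b) ⟨⟨(a, b), hab⟩, rfl⟩
      rw [inner_add_left] at this
      simp only [inner_neg_right, sub_neg_eq_add]
      rw [add_comm]; exact this
    have h0 := hT.pos_graph key
    have h1 : (inner ℂ y (-y)).re = -‖y‖ ^ 2 := by
      rw [inner_neg_right, Complex.neg_re]
      congr 1
      exact inner_self_eq_norm_sq (𝕜 := ℂ) y
    rw [h1] at h0
    have : ‖y‖ ^ 2 = 0 := le_antisymm (by linarith) (sq_nonneg _)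
    simpa using this
  let e := ContinuousLinearEquiv.ofBijective f hker hrange
  refine ⟨((ContinuousLinearMap.fst ℂ H H).comp T.graph.subtypeL).comp
    (e.symm : H →L[ℂ] T.graph), fun x z => ⟨fun h => ?_, fun h => ?_⟩⟩
  · have : e.symm (x + z) = ⟨(x, z), h⟩ := by
      rw [ContinuousLinearEquiv.symm_apply_eq]; rfl
    change x = ((e.symm (x + z) : T.graph) : H × H).1
    rw [this]
  · have h1 : f (e.symm (x + z)) = x + z := e.apply_symm_apply (x + z)
    have hx : ((e.symm (x + z) : T.graph) : H × H).1 = x := h.symm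
    rw [hf, hx] at h1
    have hz : ((e.symm (x + z) : T.graph) : H × H).2 = z := add_left_cancel h1
    have := (e.symm (x + z)).2
    rwa [show ((e.symm (x + z) : T.graph) : H × H) = (x, z) from Prod.ext hx hz] at this

/-- Every non-negative self-adjoint operator has a non-negative self-adjoint square root. With
`R = (1 + T)⁻¹`, it is the operator `√R x ↦ √(1 - R) x`. -/
theorem IsPosSelfAdjoint.exists_posSqrt {H : Type*} [NormedAddCommGroup H]
    [InnerProductSpace ℂ H] [CompleteSpace H] {T : H →ₗ.[ℂ] H} (hT : IsPosSelfAdjoint T) :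
    ∃ S : H →ₗ.[ℂ] H, IsPosSqrt S T := by
  obtain ⟨R, hR⟩ := hT.exists_resolvent
  have hRg : ∀ y : H, (R y, y - R y) ∈ T.graph := fun y => (hR _ _).mpr (by simp)
  have hsymm : (R : H →ₗ[ℂ] H).IsSymmetric := by
    intro x y
    have h := hT.symm_graph (hRg x) (hRg y)
    rw [inner_sub_left, inner_sub_right, sub_eq_sub_iff_add_eq_add] at h
    have h2 := add_right_cancel (h.trans (by rw [add_comm] : _ = inner ℂ (R x) y + inner ℂ (R x) (R y)))
    exact h2.symm ▸ rfl
  have hR0 : 0 ≤ R := by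
    rw [ContinuousLinearMap.nonneg_iff_isPositive]
    refine ⟨hsymm, fun y => ?_⟩
    have h := hT.pos_graph (hRg y)
    have h2 : (inner ℂ (R y) (y - R y)).re = (inner ℂ (R y) y).re - ‖R y‖ ^ 2 := by
      rw [inner_sub_right, Complex.sub_re]
      congr 1
      exact inner_self_eq_norm_sq (𝕜 := ℂ) (R y)
    change 0 ≤ (inner ℂ (R y) y).re
    nlinarith [sq_nonneg ‖R y‖]
  have hR1 : 0 ≤ 1 - R := by
    rw [ContinuousLinearMap.nonneg_iff_isPositive]
    refine ⟨?_, fun y => ?_⟩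
    · intro x y
      have h := hsymm x y
      change inner ℂ (x - R x) y = inner ℂ x (y - R y)
      rw [inner_sub_left, inner_sub_right]
      exact congrArg _ h
    have h := hT.pos_graph (hRg y)
    have h2 : (inner ℂ (y - R y) (y - R y)).re = ‖y - R y‖ ^ 2 :=
      inner_self_eq_norm_sq (𝕜 := ℂ) (y - R y)
    have h3 : (inner ℂ (y - R y) (R y)).re = (inner ℂ (R y) (y - R y)).re := by
      rw [← inner_conj_symm, Complex.conj_re]
    have h4 : inner ℂ (y - R y) y = inner ℂ (y - R y) (y - R y) + inner ℂ (y - R y) (R y) := by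
      rw [← inner_add_right, sub_add_cancel]
    change 0 ≤ (inner ℂ (y - R y) y).re
    rw [h4, Complex.add_re, h2, h3]
    positivity
  let B : H →L[ℂ] H := CFC.sqrt R
  let C : H →L[ℂ] H := CFC.sqrt (1 - R)
  have hB0 : 0 ≤ B := CFC.sqrt_nonneg R
  have hC0 : 0 ≤ C := CFC.sqrt_nonneg (1 - R)
  have hBB : B * B = R := CFC.sqrt_mul_sqrt_self R hR0
  have hCC : C * C = 1 - R := CFC.sqrt_mul_sqrt_self (1 - R) hR1
  have hcomm : Commute B C := by
    have h1 : Commute B (1 - R) := by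
      refine (Commute.one_right B).sub_right ?_
      rw [← hBB]
      exact (Commute.refl B).mul_right (Commute.refl B)
    have h2 : Commute (1 - R) B := h1.symm
    exact (h2.cfcₙ_nnreal _).symm
  have hBC0 : 0 ≤ B * C := hcomm.mul_nonneg hB0 hC0
  have hBs : ∀ x y, inner ℂ (B x) y = inner ℂ x (B y) :=
    ((ContinuousLinearMap.nonneg_iff_isPositive B).mp hB0).isSymmetric
  have hCs : ∀ x y, inner ℂ (C x) y = inner ℂ x (C y) :=
    ((ContinuousLinearMap.nonneg_iff_isPositive C).mp hC0).isSymmetric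
  have hBBx : ∀ x, B (B x) = R x := fun x => congrArg (fun F : H →L[ℂ] H => F x) hBB
  have hCCx : ∀ x, C (C x) = x - R x := fun x => congrArg (fun F : H →L[ℂ] H => F x) hCC
  have hBCx : ∀ x, B (C x) = C (B x) := fun x => congrArg (fun F : H →L[ℂ] H => F x) hcomm.eq
  have hRinj : ∀ y, R y = 0 → y = 0 := by
    intro y hy
    have h := hRg y
    rw [hy, sub_zero] at h
    exact LinearPMap.graph_fst_eq_zero_snd T h rfl
  have hBinj : ∀ y, B y = 0 → y = 0 := fun y hy => hRinj y (by rw [← hBBx, hy, map_zero])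
  -- two vectors with `C y = B z` come from a common vector
  have hjoint : ∀ y z, C y = B z → ∃ w, B w = y ∧ C w = z := by
    intro y z h
    refine ⟨B y + C z, ?_, ?_⟩
    · rw [map_add, hBBx, hBCx, ← h, hCCx]; abel
    · rw [map_add, ← hBCx, h, hBBx, hCCx]; abel
  let G : Submodule ℂ (H × H) := LinearMap.range ((B : H →ₗ[ℂ] H).prod (C : H →ₗ[ℂ] H))
  have hG : ∀ x z, (x, z) ∈ G ↔ ∃ w, B w = x ∧ C w = z := by
    intro x z
    refine ⟨fun ⟨w, hw⟩ => ⟨w, congrArg Prod.fst hw, congrArg Prod.snd hw⟩, fun ⟨w, h1, h2⟩ =>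
      ⟨w, Prod.ext h1 h2⟩⟩
  have hSg : G.toLinearPMap.graph = G := by
    apply Submodule.toLinearPMap_graph_eq
    rintro ⟨x, z⟩ hx (h0 : x = 0)
    obtain ⟨w, h1, h2⟩ := (hG _ _).mp hx
    change z = 0
    rw [← h2, hBinj w (h1.trans h0), map_zero]
  have hdense : Dense (G.toLinearPMap.domain : Set H) := by
    rw [Submodule.dense_iff_topologicalClosure_eq_top, Submodule.topologicalClosure_eq_top_iff,
      Submodule.eq_bot_iff]
    intro y hy
    apply hBinj
    apply ext_inner_left ℂ
    intro v
    rw [← hBs, inner_zero_right]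
    refine (Submodule.mem_orthogonal _ _).mp hy (B v) ?_
    rw [Submodule.toLinearPMap_domain]
    exact ⟨(B v, C v), (hG _ _).mpr ⟨v, rfl, rfl⟩, rfl⟩
  refine ⟨G.toLinearPMap, ⟨?_, ?_⟩, ?_⟩
  · rw [LinearPMap.isSelfAdjoint_def]
    apply LinearPMap.eq_of_eq_graph
    rw [LinearPMap.adjoint_graph_eq_graph_adjoint hdense, hSg]
    ext ⟨y, z⟩
    rw [Submodule.mem_adjoint_iff, hG]
    constructor
    · intro h
      apply hjoint
      apply ext_inner_left ℂ
      intro v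
      rw [← hBs, ← hCs]
      exact sub_eq_zero.mp (h (B v) (C v) ((hG _ _).mpr ⟨v, rfl, rfl⟩))
    · rintro ⟨w, rfl, rfl⟩ a b hab
      obtain ⟨v, rfl, rfl⟩ := (hG _ _).mp hab
      rw [hCs, hBs, hBCx, sub_self]
  · intro x
    have hx : ((x : H), G.toLinearPMap x) ∈ G := hSg.le (G.toLinearPMap.mem_graph x)
    obtain ⟨w, h1, h2⟩ := (hG _ _).mp hx
    rw [← h1, ← h2, hBs]
    exact ((ContinuousLinearMap.nonneg_iff_isPositive (B * C)).mp hBC0).re_inner_nonneg_right w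
  · intro x z
    rw [hSg]
    constructor
    · intro h
      have hx := (hR x z).mp h
      refine ⟨B (C (x + z)), (hG _ _).mpr ⟨B (x + z), ?_, ?_⟩,
        (hG _ _).mpr ⟨C (x + z), rfl, ?_⟩⟩
      · rw [hBBx]; exact hx.symm
      · rw [hBCx]
      · rw [hCCx, ← hx]; abel
    · rintro ⟨y, h1, h2⟩
      obtain ⟨u, rfl, h3⟩ := (hG _ _).mp h1
      obtain ⟨v, h4, rfl⟩ := (hG _ _).mp h2
      obtain ⟨w, rfl, rfl⟩ := hjoint u v (h3.trans h4.symm)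
      rw [hBBx, hCCx]
      exact hRg w

/-- The non-negative self-adjoint square root `T^{1/2}` of a non-negative self-adjoint operator
(and `0` for other `T`). -/
def posSqrt {H : Type*} [NormedAddCommGroup H] [InnerProductSpace ℂ H] [CompleteSpace H]
    (T : H →ₗ.[ℂ] H) : H →ₗ.[ℂ] H :=
  open Classical in if h : IsPosSelfAdjoint T then h.exists_posSqrt.choose else 0

theorem IsPosSelfAdjoint.isPosSqrt_posSqrt {H : Type*} [NormedAddCommGroup H]
    [InnerProductSpace ℂ H] [CompleteSpace H] {T : H →ₗ.[ℂ] H} (hT : IsPosSelfAdjoint T) :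
    IsPosSqrt (posSqrt T) T := by
  rw [posSqrt, dif_pos hT]
  exact hT.exists_posSqrt.choose_spec

/-- For a non-negative self-adjoint `R`, the closed quadratic form `f ↦ ‖R f‖²` of the operator
`R²`, with the value `∞` outside its form domain, which is the domain of `R`. -/
def sqForm {H : Type*} [NormedAddCommGroup H] [InnerProductSpace ℂ H]
    (R : H →ₗ.[ℂ] H) (f : H) : ℝ≥0∞ :=
  open Classical in if h : f ∈ R.domain then ‖R ⟨f, h⟩‖ₑ ^ 2 else ∞

/-- The trace, in `[0, ∞]`, of a non-negative operator given by its quadratic form `q` on a domain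
`D`: the supremum of `∑ q f` over all finite orthonormal systems in `D`. -/
def formTrace {H : Type*} [NormedAddCommGroup H] [InnerProductSpace ℂ H]
    (D : Submodule ℂ H) (q : D → ℝ≥0∞) : ℝ≥0∞ :=
  ⨆ (s : Finset D) (_ : Orthonormal ℂ (fun f : s => ((f : D) : H))), ∑ f ∈ s, q f

end Operators

/-! ### Functions of `-i∇`, weak `L_p` spaces, densities -/

section Concrete

/-- The Hilbert space `L₂(ℝᵈ)` of complex-valued functions. -/
abbrev L2 (d : ℕ) : Type := Lp ℂ 2 (volume : Measure (EuclideanSpace ℝ (Fin d)))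

/-- The function `ξ ↦ m(2πξ) (𝓕 f)(ξ)`. As `𝓕` is the unitary Fourier transform with kernel
`exp(-2πi x·ξ)`, the momentum (value of `-i∇`) that belongs to `ξ` is `2πξ`. -/
def mulFourier {d : ℕ} (m : EuclideanSpace ℝ (Fin d) → ℝ) (f : L2 d)
    (ξ : EuclideanSpace ℝ (Fin d)) : ℂ :=
  m ((2 * Real.pi) • ξ) * (𝓕 f : L2 d) ξ

theorem mulFourier_add {d : ℕ} (m : EuclideanSpace ℝ (Fin d) → ℝ) (f g : L2 d) :
    mulFourier m (f + g) =ᵐ[volume] mulFourier m f + mulFourier m g := by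
  have h : (𝓕 (f + g) : L2 d) = 𝓕 f + 𝓕 g := FourierTransform.fourier_add f g
  have h2 := Lp.coeFn_add (𝓕 f : L2 d) (𝓕 g)
  rw [← h] at h2
  filter_upwards [h2] with ξ hξ
  simp only [mulFourier, Pi.add_apply, hξ, mul_add]

theorem mulFourier_smul {d : ℕ} (m : EuclideanSpace ℝ (Fin d) → ℝ) (c : ℂ) (f : L2 d) :
    mulFourier m (c • f) =ᵐ[volume] c • mulFourier m f := by
  have h : (𝓕 (c • f) : L2 d) = c • 𝓕 f := FourierTransform.fourier_smul c f
  have h2 := Lp.coeFn_smul c (𝓕 f : L2 d)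
  rw [← h] at h2
  filter_upwards [h2] with ξ hξ
  simp only [mulFourier, Pi.smul_apply, hξ, smul_eq_mul]
  ring

/-- The operator `m(-i∇)` on `L₂(ℝᵈ)`: multiplication by `m` in momentum space, on its maximal
domain. -/
def fourierMultiplier {d : ℕ} (m : EuclideanSpace ℝ (Fin d) → ℝ) : L2 d →ₗ.[ℂ] L2 d where
  domain :=
    { carrier := {f | MemLp (mulFourier m f) 2 volume}
      zero_mem' := by
        have h := mulFourier_smul m 0 (0 : L2 d)
        rw [zero_smul, zero_smul] at h
        exact (memLp_congr_ae h).mpr MemLp.zero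
      add_mem' := fun {f g} hf hg => (memLp_congr_ae (mulFourier_add m f g)).mpr (hf.add hg)
      smul_mem' := fun c f hf =>
        (memLp_congr_ae (mulFourier_smul m c f)).mpr (MemLp.const_smul hf c) }
  toFun :=
    { toFun := fun f => 𝓕⁻ (MemLp.toLp (mulFourier m (f : L2 d)) f.2 : L2 d)
      map_add' := fun f g => by
        rw [← FourierTransform.fourierInv_add, ← MemLp.toLp_add]
        congr 1
        exact MemLp.toLp_congr _ _ (mulFourier_add m f g)
      map_smul' := fun c f => by
        rw [RingHom.id_apply, ← FourierTransform.fourierInv_smul, ← MemLp.toLp_const_smul]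
        congr 1
        exact MemLp.toLp_congr _ _ (mulFourier_smul m c f) }

/-- The (quasi-)norm of `L_{p,w}(ℝᵈ)`: `‖a‖_{p,w}^p = sup_{τ > 0} τ^p |{|a| > τ}|`. -/
def weakLpNorm {d : ℕ} (p : ℝ) (a : EuclideanSpace ℝ (Fin d) → ℝ) : ℝ≥0∞ :=
  (⨆ (τ : ℝ) (_ : 0 < τ), ENNReal.ofReal τ ^ p * volume {ξ | τ < |a ξ|}) ^ p⁻¹

/-- Multiplication by the characteristic function of a measurable set. -/
def restrictTo {d : ℕ} (Ω : Set (EuclideanSpace ℝ (Fin d))) (hΩ : MeasurableSet Ω) (f : L2 d) :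
    L2 d :=
  MemLp.toLp (Ω.indicator f) ((Lp.memLp f).indicator hΩ)

/-- `γ ≤ a(-i∇)` in the sense of quadratic forms, for non-negative self-adjoint `γ` and
non-negative `a`: the domain of `√a(-i∇)` is contained in that of `γ^{1/2}`, and
`‖γ^{1/2} f‖² ≤ ‖√a(-i∇) f‖²` there. -/
def FormLEMultiplier {d : ℕ} (γ : L2 d →ₗ.[ℂ] L2 d) (a : EuclideanSpace ℝ (Fin d) → ℝ) : Prop :=
  ∀ f : L2 d, sqForm (posSqrt γ) f ≤ sqForm (fourierMultiplier fun ξ => √(a ξ)) f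

/-- `tr γ^{1/2} a(-i∇)⁻¹ γ^{1/2}`, the trace of the quadratic form
`f ↦ ⟨γ^{1/2} f, a(-i∇)⁻¹ γ^{1/2} f⟩ = ‖a(-i∇)^{-1/2} γ^{1/2} f‖²` on the domain of `γ^{1/2}`
(which is the whole space if `γ` is bounded). -/
def traceInv {d : ℕ} (a : EuclideanSpace ℝ (Fin d) → ℝ) (γ : L2 d →ₗ.[ℂ] L2 d) : ℝ≥0∞ :=
  formTrace (posSqrt γ).domain fun f =>
    sqForm (fourierMultiplier fun ξ => (√(a ξ))⁻¹) (posSqrt γ f)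

/-- `ρ` is the diagonal `x ↦ γ(x,x)` of `γ`: for all `Ω` of finite measure, the integral of `ρ`
over `Ω` is `tr χ_Ω γ χ_Ω = ‖γ^{1/2} χ_Ω‖²` (squared Hilbert-Schmidt norm). This determines `ρ`
almost everywhere. -/
def IsDiagonal {d : ℕ} (γ : L2 d →ₗ.[ℂ] L2 d) (ρ : EuclideanSpace ℝ (Fin d) → ℝ≥0∞) : Prop :=
  AEMeasurable ρ volume ∧
    ∀ (Ω : Set (EuclideanSpace ℝ (Fin d))) (hΩ : MeasurableSet Ω), volume Ω < ∞ →
      ∫⁻ x in Ω, ρ x = formTrace (⊤ : Submodule ℂ (L2 d)) fun f =>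
        sqForm (posSqrt γ) (restrictTo Ω hΩ f)

/-- The semi-classical constant `R_{d,p}^sc = (2π)^{d/(p-1)} ((p-1)/p)^{p/(p-1)}`. -/
def semiclassicalConst (d : ℕ) (p : ℝ) : ℝ :=
  (2 * Real.pi) ^ ((d : ℝ) / (p - 1)) * ((p - 1) / p) ^ (p / (p - 1))

end Concrete

end

/-! The argument is Rumin's method. Put `S = γ^{1/2}` and choose an orthonormal basis `e i` in the
domain of `S` that spans a core. Then `ρ(x) = ∑ |S e_i (x)|²` is the diagonal of `γ`, whether or not
it is finite. For `τ > 0` split every `S e_i` into its parts with momenta in `{a > τ}` and in `{a ≤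
τ}`.

High momenta: `γ ≤ a(-i∇)` bounds the density of this part a.e. by `(2π)^{-d} ∫_{a>τ} a`, which the
weak `L_p` condition bounds by `C τ^{1-p}` with `C = (2π)^{-d} ‖a‖_{p,w}^p p/(p-1)`
(`tsum_enorm_fourierCutoff_sq_le`).

Low momenta: by the triangle inequality in `ℓ²` (`sq_sqrt_tsum_sub_le`) the density of the rest is
at least `(√ρ - √(C τ^{1-p}))₊²`. Since `a⁻¹ = ∫ 1_{a ≤ τ} τ⁻² dτ`, the sum of the trace form over
the basis is the integral over `τ`, with weight `τ⁻²`, of the total mass of this part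
(`tsum_lintegral_inv_eq`).

Exchanging the integrals over `x` and `τ` leaves a scalar integral in `τ` for each value of `ρ(x)`.
It equals a constant times `ρ^{p/(p-1)}`, and the constant is the claimed one
(`const_mul_rpow_le_lintegral`, `semiclassicalConst_mul_eq`). -/

noncomputable section

/-! ### Traces and Hilbert-Schmidt norms for unbounded square roots. -/

section HilbertSpace

variable {H : Type*} [NormedAddCommGroup H] [InnerProductSpace ℂ H]

/-- Parseval's identity. -/
theorem HilbertBasis.tsum_enorm_inner_sq {ι : Type*} (b : HilbertBasis ι ℂ H) (x : H) :
    ∑' i, ‖inner ℂ (b i) x‖ₑ ^ 2 = ‖x‖ₑ ^ 2 := by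
  have h := b.hasSum_inner_mul_inner x x
  have h2 : HasSum (fun i => ‖inner ℂ (b i) x‖ ^ 2) (‖x‖ ^ 2) := by
    have := Complex.hasSum_re h
    convert! this using 1
    · funext i
      rw [← inner_conj_symm (b i) x, RCLike.norm_conj, Complex.mul_conj']
      norm_cast
    · exact (inner_self_eq_norm_sq (𝕜 := ℂ) x).symm
  have key := ENNReal.ofReal_tsum_of_nonneg (fun i => sq_nonneg _) h2.summable
  rw [h2.tsum_eq] at key
  simpa [ENNReal.ofReal_pow, ofReal_norm] using key.symm

theorem HilbertBasis.tsum_enorm_inner_sq' {ι : Type*} (b : HilbertBasis ι ℂ H) (x : H) :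
    ∑' i, ‖inner ℂ x (b i)‖ₑ ^ 2 = ‖x‖ₑ ^ 2 := by
  rw [← b.tsum_enorm_inner_sq x]
  refine tsum_congr fun i => ?_
  rw [← inner_conj_symm, RCLike.enorm_conj]

theorem Orthonormal.sum_enorm_inner_sq_le {ι : Type*} {v : ι → H} (hv : Orthonormal ℂ v)
    (s : Finset ι) (x : H) : ∑ i ∈ s, ‖inner ℂ (v i) x‖ₑ ^ 2 ≤ ‖x‖ₑ ^ 2 := by
  have h := ENNReal.ofReal_le_ofReal (hv.sum_inner_products_le (s := s) x)
  rw [ENNReal.ofReal_sum_of_nonneg fun i _ => sq_nonneg _] at h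
  simpa [ENNReal.ofReal_pow, ofReal_norm] using h

/-- A self-adjoint `S` has an orthonormal basis in its domain that spans a core, so that `h` is in
the domain of `S` as soon as the coefficients `⟪S (b i), h⟫` are square summable. -/
theorem exists_hilbertBasis_sqForm_eq [CompleteSpace H] [SecondCountableTopology H] {S : H →ₗ.[ℂ] H}
    (hS : IsSelfAdjoint S) :
    ∃ (ι : Type) (_ : Countable ι) (b : HilbertBasis ι ℂ H) (hb : ∀ i, b i ∈ S.domain),
      ∀ h : H, sqForm S h = ∑' i, ‖inner ℂ (S ⟨b i, hb i⟩) h‖ₑ ^ 2 := by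
  have hd := hS.dense_domain
  have e : S.graph = S.graph.adjoint := by
    rw [← LinearPMap.adjoint_graph_eq_graph_adjoint hd, LinearPMap.isSelfAdjoint_def.mp hS]
  -- The sequence is dense in the graph, not merely in the domain, so its first components span a
  -- core.
  let u : ℕ → S.graph := TopologicalSpace.denseSeq S.graph
  have hu : DenseRange u := TopologicalSpace.denseRange_denseSeq _
  let v : ℕ → S.domain := fun n =>
    ⟨(u n).1.1, LinearPMap.mem_domain_of_mem_graph (u n).2⟩
  have huv : ∀ n, (u n : H × H) = ((v n : H), S (v n)) := by
    intro n
    obtain ⟨y, h1, h2⟩ := (LinearPMap.mem_graph_iff S).mp (u n).2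
    have : y = v n := Subtype.ext h1
    rw [this] at h2
    exact Prod.ext rfl h2.symm
  -- Gram-Schmidt runs inside the domain of `S`. It returns `0` at linearly dependent entries, and
  -- `ι` discards these.
  let w := InnerProductSpace.gramSchmidtNormed ℂ v
  let ι := {n | w n ≠ 0}
  let g : ι → H := fun i => (w i : H)
  have hon : Orthonormal ℂ g :=
    (InnerProductSpace.gramSchmidtNormed_orthonormal' v).comp_linearIsometry S.domain.subtypeₗᵢ
  have hspan : Submodule.span ℂ (Set.range fun i : ι => w i) = Submodule.span ℂ (Set.range v) := by
    rw [← InnerProductSpace.span_gramSchmidt ℂ v,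
      ← InnerProductSpace.span_gramSchmidtNormed_range]
    apply le_antisymm
    · exact Submodule.span_mono (by rintro _ ⟨i, rfl⟩; exact ⟨i, rfl⟩)
    · refine Submodule.span_le.mpr ?_
      rintro _ ⟨n, rfl⟩
      by_cases hn : w n = 0
      · change w n ∈ _
        rw [hn]; exact zero_mem _
      · exact Submodule.subset_span ⟨⟨n, hn⟩, rfl⟩
  -- a pair that is orthogonal to the core is orthogonal to the graph
  have hcore : ∀ y z : H, (∀ i : ι, inner ℂ (S (w i)) y = inner ℂ (g i) z) →
      (y, z) ∈ S.graph := by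
    intro y z hyz
    have h1 : ∀ x ∈ Submodule.span ℂ (Set.range v), inner ℂ (S x) y = inner ℂ (x : H) z := by
      rw [← hspan]
      intro x hx
      induction hx using Submodule.span_induction with
      | mem x hx => obtain ⟨i, rfl⟩ := hx; exact hyz i
      | zero => simp
      | add x x' _ _ h h' => simp [h, h', LinearPMap.map_add]
      | smul c x _ h => simp [h, LinearPMap.map_smul]
    have h2 : ∀ q : S.graph, inner ℂ (q : H × H).2 y = inner ℂ (q : H × H).1 z := by
      intro q
      refine hu.induction_on (p := fun q : S.graph =>
        inner ℂ (q : H × H).2 y = inner ℂ (q : H × H).1 z) q ?_ ?_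
      · exact isClosed_eq (by fun_prop) (by fun_prop)
      · intro n
        rw [huv n]
        exact h1 _ (Submodule.subset_span ⟨n, rfl⟩)
    rw [e, Submodule.mem_adjoint_iff]
    intro a b hab
    exact sub_eq_zero.mpr (h2 ⟨(a, b), hab⟩)
  have hbot : (Submodule.span ℂ (Set.range g))ᗮ = ⊥ := by
    rw [Submodule.eq_bot_iff]
    intro z hz
    -- Totality also follows from the core property: `z ⟂ g i` for all `i` puts `(0, z)` in a graph,
    -- hence `z = 0`.
    have : ((0 : H), z) ∈ S.graph := by
      apply hcore
      intro i
      rw [inner_zero_right]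
      exact ((Submodule.mem_orthogonal _ _).mp hz (g i) (Submodule.subset_span ⟨i, rfl⟩)).symm
    exact LinearPMap.graph_fst_eq_zero_snd S this rfl
  let b := HilbertBasis.mkOfOrthogonalEqBot hon hbot
  have hbg : ∀ i, b i = g i := fun i => by
    rw [show (b : ι → H) = g from HilbertBasis.coe_mkOfOrthogonalEqBot hon hbot]
  have hb : ∀ i, b i ∈ S.domain := fun i => by rw [hbg]; exact (w i).2
  have hbw : ∀ i, S ⟨b i, hb i⟩ = S (w i) := fun i => by
    congr 1; exact Subtype.ext (hbg i)
  have hval : ∀ y z : H, (y, z) ∈ S.graph →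
      ‖z‖ₑ ^ 2 = ∑' i, ‖inner ℂ (S ⟨b i, hb i⟩) y‖ₑ ^ 2 := by
    intro y z hyz
    rw [← b.tsum_enorm_inner_sq z]
    refine tsum_congr fun i => ?_
    rw [e, Submodule.mem_adjoint_iff] at hyz
    rw [← sub_eq_zero.mp (hyz (b i) (S ⟨b i, hb i⟩) (S.mem_graph ⟨b i, hb i⟩))]
  refine ⟨ι, inferInstance, b, hb, fun h => ?_⟩
  by_cases hh : h ∈ S.domain
  · rw [sqForm, dif_pos hh]
    exact hval _ _ (S.mem_graph ⟨h, hh⟩)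
  · rw [sqForm, dif_neg hh]
    by_contra hfin
    apply hh
    have hsum : ∑' i, ‖inner ℂ (S ⟨b i, hb i⟩) h‖ₑ ^ 2 ≠ ∞ := Ne.symm hfin
    -- Square summable coefficients define a vector `z`, the candidate for `S h`. The core property
    -- then puts `(h, z)` in the graph, contradicting `hh`.
    have hmem : Memℓp (fun i => inner ℂ (S ⟨b i, hb i⟩) h) 2 := by
      apply memℓp_gen
      have := ENNReal.summable_toReal hsum
      convert! this using 2 with i
      simp
    let z := b.repr.symm ⟨_, hmem⟩
    have hz : ∀ i, inner ℂ (b i) z = inner ℂ (S ⟨b i, hb i⟩) h := by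
      intro i
      rw [← b.repr_apply_apply, LinearIsometryEquiv.apply_symm_apply]
    exact LinearPMap.mem_domain_of_mem_graph (hcore h z fun i => by rw [← hbw, ← hz, hbg])

/-- The Hilbert-Schmidt norms of `B S` and of its adjoint `S B†`. -/
theorem tsum_enorm_apply_sq_eq_tsum_sqForm_adjoint {ι : Type*} {S : H →ₗ.[ℂ] H}
    {b : HilbertBasis ι ℂ H} {hb : ∀ i, b i ∈ S.domain}
    (hS : ∀ h : H, sqForm S h = ∑' i, ‖inner ℂ (S ⟨b i, hb i⟩) h‖ₑ ^ 2) (B B' : H → H)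
    (hB : ∀ x y, inner ℂ (B x) y = inner ℂ x (B' y)) :
    ∑' i, ‖B (S ⟨b i, hb i⟩)‖ₑ ^ 2 = ∑' j, sqForm S (B' (b j)) := by
  -- Both sides are the double sum of `|⟪S (b i), B' (b j)⟫|²`.
  simp_rw [hS]
  rw [ENNReal.tsum_comm]
  refine tsum_congr fun i => ?_
  rw [← b.tsum_enorm_inner_sq']
  exact tsum_congr fun j => by rw [hB]

/-- Finite subfamilies of `b` compete in the supremum. For `traceInv` this direction alone suffices,
so the value of that trace need not be computed in a basis. -/
theorem tsum_le_formTrace {ι : Type*} {D : Submodule ℂ H} (q : D → ℝ≥0∞)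
    {b : ι → H} (ho : Orthonormal ℂ b) (hb : ∀ i, b i ∈ D) :
    ∑' i, q ⟨b i, hb i⟩ ≤ formTrace D q := by
  rw [ENNReal.tsum_eq_iSup_sum]
  refine iSup_le fun t => ?_
  classical
  have hinj : Function.Injective fun i => (⟨b i, hb i⟩ : D) :=
    fun i j hij => ho.linearIndependent.injective (congrArg Subtype.val hij)
  refine le_trans ?_ (le_iSup₂ (t.map ⟨_, hinj⟩) ?_)
  · rw [Finset.sum_map]
    exact le_rfl
  · refine ho.toSubtypeRange.comp (fun f : t.map ⟨_, hinj⟩ => ⟨((f : D) : H), ?_⟩) ?_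
    · obtain ⟨i, _, hi⟩ := Finset.mem_map.mp f.2
      exact ⟨i, by rw [← hi]; rfl⟩
    · intro f f' h
      have h2 := congrArg Subtype.val h
      exact Subtype.ext (Subtype.ext h2)

/-- The trace of the form of `S²` compressed by `B†` is the squared Hilbert-Schmidt norm of
`B S`. -/
theorem formTrace_sqForm_eq_tsum {ι : Type*} {S : H →ₗ.[ℂ] H}
    {b : HilbertBasis ι ℂ H} {hb : ∀ i, b i ∈ S.domain}
    (hS : ∀ h : H, sqForm S h = ∑' i, ‖inner ℂ (S ⟨b i, hb i⟩) h‖ₑ ^ 2) (B B' : H → H)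
    (hB : ∀ x y, inner ℂ (B x) y = inner ℂ x (B' y)) :
    formTrace (⊤ : Submodule ℂ H) (fun f => sqForm S (B' f)) =
      ∑' i, ‖B (S ⟨b i, hb i⟩)‖ₑ ^ 2 := by
  apply le_antisymm
  · refine iSup₂_le fun s hs => ?_
    simp_rw [hS, ← hB]
    rw [← Summable.tsum_finsetSum fun _ _ => ENNReal.summable]
    refine ENNReal.tsum_le_tsum fun i => ?_
    -- Bessel's inequality for the orthonormal system `s`, separately for each vector `B (S (b i))`.
    have := hs.sum_enorm_inner_sq_le Finset.univ (B (S ⟨b i, hb i⟩))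
    rw [← Finset.sum_coe_sort]
    refine le_trans (le_of_eq (Finset.sum_congr rfl fun f _ => ?_)) this
    rw [← inner_conj_symm, RCLike.enorm_conj]
  · rw [tsum_enorm_apply_sq_eq_tsum_sqForm_adjoint hS B B' hB]
    let q : (⊤ : Submodule ℂ H) → ℝ≥0∞ := fun f => sqForm S (B' f)
    exact tsum_le_formTrace q b.orthonormal fun _ => Submodule.mem_top

end HilbertSpace

/-! ### Cutoffs in position and momentum, and Fourier multipliers on `L²`. -/

section FourierL2

variable {d : ℕ}

/-- The Fourier transform of an `L²` function that is also integrable is given by the Fourier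
integral. -/
theorem fourier_coeFn_ae_eq_of_integrable (f : L2 d) (hf : Integrable f) :
    (𝓕 f : L2 d) =ᵐ[volume] 𝓕 (f : EuclideanSpace ℝ (Fin d) → ℂ) := by
  have hcont : Continuous (𝓕 (f : EuclideanSpace ℝ (Fin d) → ℂ)) :=
    VectorFourier.fourierIntegral_continuous Real.continuous_fourierChar
      (by exact continuous_inner) hf
  apply ae_eq_of_integral_contDiff_smul_eq
  · exact (Lp.memLp (𝓕 f : L2 d)).locallyIntegrable (by norm_num)
  · exact hcont.locallyIntegrable
  · intro g g_smooth g_cpt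
    have hg₁ : HasCompactSupport (Complex.ofRealCLM ∘ g) := g_cpt.comp_left rfl
    have hg₂ : ContDiff ℝ (⊤ : ℕ∞) (Complex.ofRealCLM ∘ g) := by fun_prop
    let φ := hg₁.toSchwartzMap hg₂
    have h1 : ∀ x, φ x = (g x : ℂ) := fun x => rfl
    -- Either transform of `f` can be moved onto the test function: the `L²` one by duality of
    -- distributions, the integral one by Fubini.
    have key : Lp.toTemperedDistribution (𝓕 f : L2 d) φ = Lp.toTemperedDistribution f (𝓕 φ) := by
      rw [← Lp.fourier_toTemperedDistribution_eq, TemperedDistribution.fourier_apply]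
    rw [Lp.toTemperedDistribution_apply, Lp.toTemperedDistribution_apply] at key
    have h2 := VectorFourier.integral_fourierIntegral_smul_eq_flip (μ := volume) (ν := volume)
      (L := innerₗ (EuclideanSpace ℝ (Fin d))) (f := φ) (g := f) Real.continuous_fourierChar
      (by exact continuous_inner) φ.integrable hf
    rw [flip_innerₗ] at h2
    have h3 : ∫ x, (𝓕 φ) x • f x = ∫ x, φ x • 𝓕 (f : EuclideanSpace ℝ (Fin d) → ℂ) x := by
      rw [SchwartzMap.fourier_coe]
      exact h2
    rw [h3] at key
    simpa [h1] using key

theorem restrictTo_coeFn (Ω : Set (EuclideanSpace ℝ (Fin d))) (hΩ : MeasurableSet Ω) (f : L2 d) :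
    restrictTo Ω hΩ f =ᵐ[volume] Ω.indicator f :=
  MemLp.coeFn_toLp _

theorem enorm_sq_eq_lintegral {E : Type*} [NormedAddCommGroup E] {α : Type*} [MeasurableSpace α]
    {μ : Measure α} (f : Lp E 2 μ) : ‖f‖ₑ ^ 2 = ∫⁻ x, ‖f x‖ₑ ^ 2 ∂μ := by
  rw [Lp.enorm_def, eLpNorm_eq_lintegral_rpow_enorm_toReal (by norm_num) (by norm_num)]
  simp only [ENNReal.toReal_ofNat, ENNReal.rpow_ofNat]
  rw [← ENNReal.rpow_natCast, ← ENNReal.rpow_mul]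
  norm_num

theorem enorm_restrictTo_sq (Ω : Set (EuclideanSpace ℝ (Fin d))) (hΩ : MeasurableSet Ω)
    (f : L2 d) : ‖restrictTo Ω hΩ f‖ₑ ^ 2 = ∫⁻ x in Ω, ‖f x‖ₑ ^ 2 := by
  rw [enorm_sq_eq_lintegral, ← lintegral_indicator hΩ]
  refine lintegral_congr_ae ?_
  filter_upwards [restrictTo_coeFn Ω hΩ f] with x hx
  rw [hx]
  by_cases h : x ∈ Ω <;> simp [h]

theorem inner_restrictTo (Ω : Set (EuclideanSpace ℝ (Fin d))) (hΩ : MeasurableSet Ω)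
    (f g : L2 d) : inner ℂ (restrictTo Ω hΩ f) g = inner ℂ f (restrictTo Ω hΩ g) := by
  rw [L2.inner_def, L2.inner_def]
  refine integral_congr_ae ?_
  filter_upwards [restrictTo_coeFn Ω hΩ f, restrictTo_coeFn Ω hΩ g] with x hx hx'
  rw [hx, hx']
  by_cases h : x ∈ Ω <;> simp [h]

/-- The spectral projection of `-i∇` that cuts off the Fourier transform to the set `A`. -/
def fourierCutoff (A : Set (EuclideanSpace ℝ (Fin d))) (hA : MeasurableSet A) (f : L2 d) : L2 d :=
  𝓕⁻ (restrictTo A hA (𝓕 f))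

theorem fourier_fourierCutoff (A : Set (EuclideanSpace ℝ (Fin d))) (hA : MeasurableSet A)
    (f : L2 d) : (𝓕 (fourierCutoff A hA f) : L2 d) = restrictTo A hA (𝓕 f) :=
  FourierTransform.fourier_fourierInv_eq _

theorem inner_fourierCutoff (A : Set (EuclideanSpace ℝ (Fin d))) (hA : MeasurableSet A)
    (f g : L2 d) : inner ℂ (fourierCutoff A hA f) g = inner ℂ f (fourierCutoff A hA g) := by
  rw [← Lp.inner_fourier_eq, ← Lp.inner_fourier_eq f, fourier_fourierCutoff,
    fourier_fourierCutoff, inner_restrictTo]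

theorem enorm_fourierCutoff_sq (A : Set (EuclideanSpace ℝ (Fin d))) (hA : MeasurableSet A)
    (f : L2 d) : ‖fourierCutoff A hA f‖ₑ ^ 2 = ∫⁻ ξ in A, ‖(𝓕 f : L2 d) ξ‖ₑ ^ 2 := by
  rw [← enorm_restrictTo_sq A hA, ← fourier_fourierCutoff, ← ofReal_norm, ← ofReal_norm,
    Lp.norm_fourier_eq]

theorem fourierCutoff_add_compl (A : Set (EuclideanSpace ℝ (Fin d))) (hA : MeasurableSet A)
    (f : L2 d) : fourierCutoff A hA f + fourierCutoff Aᶜ hA.compl f = f := by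
  rw [fourierCutoff, fourierCutoff, ← FourierTransform.fourierInv_add]
  have : restrictTo A hA (𝓕 f) + restrictTo Aᶜ hA.compl (𝓕 f) = 𝓕 f := by
    apply Lp.ext
    filter_upwards [Lp.coeFn_add (restrictTo A hA (𝓕 f)) (restrictTo Aᶜ hA.compl (𝓕 f)),
      restrictTo_coeFn A hA (𝓕 f), restrictTo_coeFn Aᶜ hA.compl (𝓕 f)] with x h1 h2 h3
    rw [h1, Pi.add_apply, h2, h3]
    by_cases h : x ∈ A <;> simp [h]
  rw [this, FourierTransform.fourierInv_fourier_eq]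

theorem quasiMeasurePreserving_two_pi_smul :
    Measure.QuasiMeasurePreserving
      (fun ξ : EuclideanSpace ℝ (Fin d) => (2 * Real.pi) • ξ) volume volume :=
  Measure.quasiMeasurePreserving_smul volume (by positivity)

/-- The quadratic form of `m(-i∇)²`. -/
theorem sqForm_fourierMultiplier (m : EuclideanSpace ℝ (Fin d) → ℝ) (hm : AEMeasurable m volume)
    (f : L2 d) : sqForm (fourierMultiplier m) f =
      ∫⁻ ξ, ‖m ((2 * Real.pi) • ξ)‖ₑ ^ 2 * ‖(𝓕 f : L2 d) ξ‖ₑ ^ 2 := by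
  have hmeas : AEStronglyMeasurable (mulFourier m f) volume := by
    refine AEStronglyMeasurable.mul ?_ (Lp.aestronglyMeasurable _)
    exact (Complex.measurable_ofReal.comp_aemeasurable
      (hm.comp_quasiMeasurePreserving quasiMeasurePreserving_two_pi_smul)).aestronglyMeasurable
  have hpt : ∀ ξ, ‖mulFourier m f ξ‖ₑ ^ 2 =
      ‖m ((2 * Real.pi) • ξ)‖ₑ ^ 2 * ‖(𝓕 f : L2 d) ξ‖ₑ ^ 2 := by
    intro ξ
    rw [mulFourier, enorm_mul, mul_pow, ← ofReal_norm, Complex.norm_real, ofReal_norm]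
  have hnorm : eLpNorm (mulFourier m f) 2 volume ^ 2 = ∫⁻ ξ, ‖mulFourier m f ξ‖ₑ ^ 2 := by
    rw [eLpNorm_eq_lintegral_rpow_enorm_toReal (by norm_num) (by norm_num)]
    simp only [ENNReal.toReal_ofNat, ENNReal.rpow_ofNat]
    rw [← ENNReal.rpow_natCast, ← ENNReal.rpow_mul]
    norm_num
  simp_rw [← hpt]
  rw [← hnorm]
  by_cases h : MemLp (mulFourier m f) 2 volume
  · rw [sqForm, dif_pos (show f ∈ (fourierMultiplier m).domain from h)]
    change ‖(𝓕⁻ (MemLp.toLp (mulFourier m f) h : L2 d) : L2 d)‖ₑ ^ 2 = _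
    rw [← Lp.enorm_toLp (f := mulFourier m f) h, ← ofReal_norm, ← ofReal_norm,
      ← Lp.norm_fourier_eq, FourierTransform.fourier_fourierInv_eq]
  -- Measurability is automatic, so leaving the domain can only mean that the integral is infinite.
  · rw [sqForm, dif_neg (show f ∉ (fourierMultiplier m).domain from h)]
    have : eLpNorm (mulFourier m f) 2 volume = ∞ := by
      by_contra h'
      exact h ⟨hmeas, lt_top_iff_ne_top.mpr h'⟩
    rw [this]
    rfl

/-- The kernel of `𝓕 χ_Ω` is square integrable in the position variable. -/
theorem tsum_enorm_fourier_restrictTo_sq {ι : Type*} [Countable ι] (b : HilbertBasis ι ℂ (L2 d))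
    (Ω : Set (EuclideanSpace ℝ (Fin d))) (hΩ : MeasurableSet Ω) (hfin : volume Ω < ∞) :
    ∀ᵐ ξ, ∑' i, ‖(𝓕 (restrictTo Ω hΩ (b i)) : L2 d) ξ‖ₑ ^ 2 = volume Ω := by
  -- With this kernel `(𝓕 χ_Ω f)(ξ) = ⟪k ξ, f⟫`. Parseval turns the sum over the basis into `‖k
  -- ξ‖²`, which is `|Ω|` because the exponential has modulus one.
  let k : EuclideanSpace ℝ (Fin d) → EuclideanSpace ℝ (Fin d) → ℂ := fun ξ x =>
    Ω.indicator (fun x => ((Real.fourierChar (inner ℝ x ξ) : Circle) : ℂ)) x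
  have hk : ∀ ξ, MemLp (k ξ) 2 volume := by
    intro ξ
    refine (memLp_indicator_iff_restrict hΩ).mpr ?_
    have : IsFiniteMeasure (volume.restrict Ω) := ⟨by simpa using hfin⟩
    refine MemLp.of_bound (C := 1) ?_ (Filter.Eventually.of_forall fun x => (Circle.norm_coe _).le)
    refine Continuous.aestronglyMeasurable ?_
    have := Real.continuous_fourierChar
    fun_prop
  have hint : ∀ f : L2 d, Integrable (restrictTo Ω hΩ f) := by
    intro f
    rw [integrable_congr (restrictTo_coeFn Ω hΩ f), integrable_indicator_iff hΩ]
    have : IsFiniteMeasure (volume.restrict Ω) := ⟨by simpa using hfin⟩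
    exact (((Lp.memLp f).restrict Ω).integrable (by norm_num))
  have hF : ∀ (f : L2 d) ξ, 𝓕 (restrictTo Ω hΩ f : EuclideanSpace ℝ (Fin d) → ℂ) ξ =
      inner ℂ ((hk ξ).toLp (k ξ)) f := by
    intro f ξ
    rw [Real.fourier_eq, L2.inner_def]
    refine integral_congr_ae ?_
    filter_upwards [restrictTo_coeFn Ω hΩ f, (hk ξ).coeFn_toLp] with x h1 h2
    rw [h1, h2]
    by_cases h : x ∈ Ω
    · simp [k, h, Circle.smul_def, mul_comm, AddChar.map_neg_eq_inv]
    · simp [k, h]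
  have hae : ∀ᵐ ξ, ∀ i, (𝓕 (restrictTo Ω hΩ (b i)) : L2 d) ξ =
      inner ℂ ((hk ξ).toLp (k ξ)) (b i) := by
    rw [ae_all_iff]
    intro i
    filter_upwards [fourier_coeFn_ae_eq_of_integrable _ (hint (b i))] with ξ hξ
    rw [hξ, hF]
  filter_upwards [hae] with ξ hξ
  simp_rw [hξ]
  rw [b.tsum_enorm_inner_sq', enorm_sq_eq_lintegral, ← setLIntegral_one,
    ← lintegral_indicator hΩ]
  refine lintegral_congr_ae ?_
  filter_upwards [(hk ξ).coeFn_toLp] with x hx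
  rw [hx]
  by_cases h : x ∈ Ω
  · simp [k, h, ← ofReal_norm, Circle.norm_coe]
  · simp [k, h]

end FourierL2

/-! ### Scalar inequalities and explicit integrals. -/

section ScalarInequalities

/-- The reverse triangle inequality in `ℓ²`. -/
theorem sq_sqrt_tsum_sub_le {ι : Type*} (h u v : ι → ℝ≥0∞) (c : ℝ≥0∞)
    (huv : ∀ i, h i ≤ u i + v i) (hu : ∑' i, u i ^ 2 ≤ c) :
    ((∑' i, h i ^ 2) ^ (1 / 2 : ℝ) - c ^ (1 / 2 : ℝ)) ^ 2 ≤ ∑' i, v i ^ 2 := by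
  have hsq : ∀ x : ℝ≥0∞, (x ^ (1 / 2 : ℝ)) ^ 2 = x := fun x => by
    rw [← ENNReal.rpow_natCast, ← ENNReal.rpow_mul]; norm_num
  have hsq' : ∀ x : ℝ≥0∞, (x ^ 2) ^ (1 / 2 : ℝ) = x := fun x => by
    rw [← ENNReal.rpow_natCast, ← ENNReal.rpow_mul]; norm_num
  have hmink : (∑' i, h i ^ 2) ^ (1 / 2 : ℝ) ≤ c ^ (1 / 2 : ℝ) + (∑' i, v i ^ 2) ^ (1 / 2 : ℝ) := by
    rw [← hsq' (c ^ (1 / 2 : ℝ) + _)]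
    refine ENNReal.rpow_le_rpow ?_ (by norm_num)
    rw [ENNReal.tsum_eq_iSup_sum]
    refine iSup_le fun s => ?_
    have h1 := ENNReal.Lp_add_le s u v (p := 2) (by norm_num)
    simp only [ENNReal.rpow_ofNat] at h1
    have h2 : (∑ i ∈ s, h i ^ 2) ^ (1 / 2 : ℝ) ≤ c ^ (1 / 2 : ℝ) + (∑' i, v i ^ 2) ^ (1 / 2 : ℝ) := by
      refine le_trans (ENNReal.rpow_le_rpow (Finset.sum_le_sum fun i _ => ?_) (by norm_num))
        (h1.trans (add_le_add (ENNReal.rpow_le_rpow ?_ (by norm_num))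
          (ENNReal.rpow_le_rpow ?_ (by norm_num))))
      · exact pow_le_pow_left' (huv i) 2
      · exact (ENNReal.sum_le_tsum s).trans hu
      · exact ENNReal.sum_le_tsum s
    calc ∑ i ∈ s, h i ^ 2 = ((∑ i ∈ s, h i ^ 2) ^ (1 / 2 : ℝ)) ^ 2 := (hsq _).symm
      _ ≤ _ := pow_le_pow_left' h2 2
  -- Subtraction in `ℝ≥0∞` is truncated, so the left side is the square of a positive part and no
  -- case distinction is needed.
  calc _ ≤ ((∑' i, v i ^ 2) ^ (1 / 2 : ℝ)) ^ 2 :=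
        pow_le_pow_left' (tsub_le_iff_left.mpr hmink) 2
    _ = _ := hsq _

theorem ofReal_integral_Ioi_rpow {q c : ℝ} (hq : q < -1) (hc : 0 < c) :
    ∫⁻ t in Set.Ioi c, ENNReal.ofReal (t ^ q) = ENNReal.ofReal (c ^ (q + 1) / (-(q + 1))) := by
  rw [← ofReal_integral_eq_lintegral_ofReal (integrableOn_Ioi_rpow_of_lt hq hc),
    integral_Ioi_rpow_of_lt hq hc, div_neg, neg_div]
  filter_upwards [ae_restrict_mem measurableSet_Ioi] with t ht
  exact Real.rpow_nonneg (hc.trans ht).le _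

/-- The representation `β⁻¹ = ∫ 1_{β ≤ τ} τ⁻² dτ`. -/
theorem lintegral_Ioi_indicator_rpow_neg_two {β : ℝ} (hβ : 0 < β) :
    ∫⁻ τ in Set.Ioi (0 : ℝ), ENNReal.ofReal (τ ^ (-2 : ℝ)) * (Set.Iic τ).indicator 1 β =
      ENNReal.ofReal β⁻¹ := by
  have h1 : ∀ τ : ℝ, ENNReal.ofReal (τ ^ (-2 : ℝ)) * (Set.Iic τ).indicator 1 β =
      (Set.Ici β).indicator (fun τ => ENNReal.ofReal (τ ^ (-2 : ℝ))) τ := by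
    intro τ
    by_cases h : β ≤ τ <;> simp [h]
  simp_rw [h1]
  rw [lintegral_indicator measurableSet_Ici, Measure.restrict_restrict measurableSet_Ici,
    Set.inter_eq_left.mpr (Set.Ici_subset_Ioi.mpr hβ),
    setLIntegral_congr Ioi_ae_eq_Ici.symm,
    ofReal_integral_Ioi_rpow (by norm_num) hβ]
  norm_num [Real.rpow_neg_one]

/-- The part of a weak `L_p` function above the level `τ`. -/
theorem setLIntegral_superlevel_le {α : Type*} [MeasurableSpace α] {μ : Measure α} {b : α → ℝ}
    (hb : Measurable b) {p K τ : ℝ} (hp : 1 < p) (hK : 0 ≤ K) (hτ : 0 < τ)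
    (h : ∀ s, 0 < s → μ {x | s < b x} ≤ ENNReal.ofReal (K * s ^ (-p))) :
    ∫⁻ x in {x | τ < b x}, ENNReal.ofReal (b x) ∂μ ≤
      ENNReal.ofReal (K * (p / (p - 1)) * τ ^ (1 - p)) := by
  have hA : MeasurableSet {x | τ < b x} := measurableSet_lt measurable_const hb
  rw [lintegral_eq_lintegral_meas_lt _ ?_ hb.aemeasurable]
  swap
  · filter_upwards [ae_restrict_mem hA] with x hx
    exact (hτ.trans hx).le
  -- Below `τ` the distribution function of the restricted function is at most `K τ^{-p}`; above `τ`
  -- it is at most `K t^{-p}`. The two contributions add up to the factor `1 + 1/(p-1) = p/(p-1)`.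
  rw [← Set.Ioc_union_Ioi_eq_Ioi hτ.le]
  refine (lintegral_union_le _ _ _).trans ?_
  have h1 : ∫⁻ t in Set.Ioc 0 τ, μ.restrict {x | τ < b x} {x | t < b x} ≤
      ENNReal.ofReal (K * τ ^ (1 - p)) := by
    calc _ ≤ ∫⁻ t in Set.Ioc 0 τ, ENNReal.ofReal (K * τ ^ (-p)) := by
          refine lintegral_mono fun t => ?_
          exact (measure_mono (Set.subset_univ _)).trans
            (by rw [Measure.restrict_apply_univ]; exact h τ hτ)
      _ = _ := by
          rw [setLIntegral_const, Real.volume_Ioc, sub_zero, ← ENNReal.ofReal_mul (by positivity),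
            mul_assoc, ← Real.rpow_add_one hτ.ne']
          ring_nf
  have h2 : ∫⁻ t in Set.Ioi τ, μ.restrict {x | τ < b x} {x | t < b x} ≤
      ENNReal.ofReal (K * (τ ^ (1 - p) / (p - 1))) := by
    calc _ ≤ ∫⁻ t in Set.Ioi τ, ENNReal.ofReal K * ENNReal.ofReal (t ^ (-p)) := by
          refine setLIntegral_mono' measurableSet_Ioi fun t ht => ?_
          rw [← ENNReal.ofReal_mul hK]
          exact (Measure.restrict_apply_le _ _).trans (h t (hτ.trans ht))
      _ = _ := by
          rw [lintegral_const_mul' _ _ ENNReal.ofReal_ne_top,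
            ofReal_integral_Ioi_rpow (by linarith) hτ, ← ENNReal.ofReal_mul hK]
          ring_nf
  refine (add_le_add h1 h2).trans (le_of_eq ?_)
  have hp1 : 0 < p - 1 := by linarith
  rw [← ENNReal.ofReal_add (by positivity) (by positivity)]
  congr 1
  field_simp
  ring

/-- Expanding the square leaves three powers of `τ`, and `1 - 4/(p+1) + 1/p = (p-1)²/(p(p+1))`. -/
theorem integral_Ioi_sq_sub_rpow {p τ₀ : ℝ} (hp : 1 < p) (hτ : 0 < τ₀) :
    ENNReal.ofReal ((p - 1) ^ 2 / (p * (p + 1)) * τ₀⁻¹) =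
      ∫⁻ τ in Set.Ioi τ₀, ENNReal.ofReal
        (τ ^ (-2 : ℝ) * (1 - τ₀ ^ ((p - 1) / 2) * τ ^ ((1 - p) / 2)) ^ 2) := by
  have e : ∀ τ ∈ Set.Ioi τ₀,
      τ ^ (-2 : ℝ) * (1 - τ₀ ^ ((p - 1) / 2) * τ ^ ((1 - p) / 2)) ^ 2 =
      τ ^ (-2 : ℝ) - 2 * τ₀ ^ ((p - 1) / 2) * τ ^ (-(p + 3) / 2) +
        τ₀ ^ (p - 1) * τ ^ (-(p + 1)) := by
    intro τ h
    have hτ' : 0 < τ := hτ.trans h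
    have e1 : τ ^ (-(p + 3) / 2) = τ ^ (-2 : ℝ) * τ ^ ((1 - p) / 2) := by
      rw [← Real.rpow_add hτ']; ring_nf
    have e2 : τ ^ (-(p + 1)) = τ ^ (-2 : ℝ) * (τ ^ ((1 - p) / 2)) ^ 2 := by
      rw [← Real.rpow_natCast, ← Real.rpow_mul hτ'.le, ← Real.rpow_add hτ']; push_cast; ring_nf
    have e3 : τ₀ ^ (p - 1) = (τ₀ ^ ((p - 1) / 2)) ^ 2 := by
      rw [← Real.rpow_natCast, ← Real.rpow_mul hτ.le]; push_cast; ring_nf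
    rw [e1, e2, e3]; ring
  have i1 := integrableOn_Ioi_rpow_of_lt (show (-2 : ℝ) < -1 by norm_num) hτ
  have i2 := (integrableOn_Ioi_rpow_of_lt (show -(p + 3) / 2 < -1 by linarith) hτ).const_mul
    (2 * τ₀ ^ ((p - 1) / 2))
  have i3 := (integrableOn_Ioi_rpow_of_lt (show -(p + 1) < -1 by linarith) hτ).const_mul
    (τ₀ ^ (p - 1))
  have i12 := i1.sub i2
  rw [← ofReal_integral_eq_lintegral_ofReal]
  · congr 1
    rw [setIntegral_congr_fun measurableSet_Ioi e]
    rw [integral_add (by exact i12) (by exact i3), integral_sub (by exact i1) (by exact i2),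
      integral_const_mul, integral_const_mul, integral_Ioi_rpow_of_lt (by norm_num) hτ,
      integral_Ioi_rpow_of_lt (by linarith) hτ, integral_Ioi_rpow_of_lt (by linarith) hτ]
    have f1 : τ₀ ^ ((-2 : ℝ) + 1) = τ₀⁻¹ := by rw [← Real.rpow_neg_one]; norm_num
    have f2 : τ₀ ^ (-(p + 3) / 2 + 1) = τ₀⁻¹ * (τ₀ ^ ((p - 1) / 2))⁻¹ := by
      rw [← Real.rpow_neg_one, ← Real.rpow_neg hτ.le, ← Real.rpow_add hτ]; ring_nf
    have f3 : τ₀ ^ (-(p + 1) + 1) = τ₀⁻¹ * (τ₀ ^ (p - 1))⁻¹ := by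
      rw [← Real.rpow_neg_one, ← Real.rpow_neg hτ.le, ← Real.rpow_add hτ]; ring_nf
    rw [f1, f2, f3]
    have n1 : τ₀ ^ ((p - 1) / 2) ≠ 0 := (Real.rpow_pos_of_pos hτ _).ne'
    have n2 : τ₀ ^ (p - 1) ≠ 0 := (Real.rpow_pos_of_pos hτ _).ne'
    have n3 : p + 1 ≠ 0 := by linarith
    have n4 : -(p + 3) / 2 + 1 ≠ 0 := by linarith
    have n5 : -(p + 1) + 1 ≠ 0 := by linarith
    have n6 : p ≠ 0 := by linarith
    have g2 : -(p + 3) / 2 + 1 = -((p + 1) / 2) := by ring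
    have g3 : -(p + 1) + 1 = -p := by ring
    rw [g2, g3]
    field_simp
    ring
  · exact (integrableOn_congr_fun e measurableSet_Ioi).mpr (i12.add i3)
  · filter_upwards [ae_restrict_mem measurableSet_Ioi] with t ht
    have : 0 < t := hτ.trans ht
    change 0 ≤ _
    positivity

/-- The scalar integral behind the Rumin-type bound on the density. -/
theorem const_mul_rpow_le_lintegral {p C : ℝ} (hp : 1 < p) (hC : 0 < C) (ρ : ℝ≥0∞) :
    ENNReal.ofReal ((p - 1) ^ 2 / (p * (p + 1)) * C ^ (-(1 / (p - 1)))) * ρ ^ (p / (p - 1)) ≤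
      ∫⁻ τ in Set.Ioi (0 : ℝ), ENNReal.ofReal (τ ^ (-2 : ℝ)) *
        (ρ ^ (1 / 2 : ℝ) - ENNReal.ofReal (C * τ ^ (1 - p)) ^ (1 / 2 : ℝ)) ^ 2 := by
  have hp1 : 0 < p - 1 := by linarith
  have hp0 : 0 < p := by linarith
  rcases eq_or_ne ρ ∞ with rfl | hρ
  · have : ∫⁻ τ in Set.Ioi (0 : ℝ), ENNReal.ofReal (τ ^ (-2 : ℝ)) *
        ((∞ : ℝ≥0∞) ^ (1 / 2 : ℝ) - ENNReal.ofReal (C * τ ^ (1 - p)) ^ (1 / 2 : ℝ)) ^ 2 = ∞ := by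
      rw [setLIntegral_congr_fun (g := fun _ => ∞) measurableSet_Ioi]
      · simp
      · intro τ (hτ : 0 < τ)
        have h1 : ENNReal.ofReal (C * τ ^ (1 - p)) ^ (1 / 2 : ℝ) ≠ ∞ :=
          ENNReal.rpow_ne_top_of_nonneg (by norm_num) ENNReal.ofReal_ne_top
        have h2 : ENNReal.ofReal (τ ^ (-2 : ℝ)) ≠ 0 := by
          exact (ENNReal.ofReal_pos.mpr (Real.rpow_pos_of_pos hτ (-2))).ne'
        simp only
        rw [ENNReal.top_rpow_of_pos (by norm_num), ENNReal.top_sub h1, ENNReal.top_pow two_ne_zero,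
          ENNReal.mul_top h2]
    rw [this]
    exact le_top
  rcases eq_or_ne ρ 0 with rfl | hρ0
  · rw [ENNReal.zero_rpow_of_pos (by positivity), mul_zero]
    exact zero_le
  obtain ⟨r, hr, rfl⟩ : ∃ r : ℝ, 0 < r ∧ ρ = ENNReal.ofReal r :=
    ⟨ρ.toReal, ENNReal.toReal_pos hρ0 hρ, (ENNReal.ofReal_toReal hρ).symm⟩
  -- The solution of `r = C τ^{1-p}`. Up to this level the truncated difference vanishes, so only `τ
  -- > τ₀` contributes.
  let τ₀ : ℝ := (C / r) ^ (1 / (p - 1))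
  have hτ₀ : 0 < τ₀ := by positivity
  have hCr : C = r * τ₀ ^ (p - 1) := by
    simp only [τ₀]
    rw [← Real.rpow_mul (by positivity), one_div_mul_cancel hp1.ne', Real.rpow_one]
    field_simp
  have hconst : C ^ (-(1 / (p - 1))) * r ^ (p / (p - 1)) = r * τ₀⁻¹ := by
    simp only [τ₀]
    rw [Real.div_rpow hC.le hr.le, Real.rpow_neg hC.le,
      show p / (p - 1) = 1 + 1 / (p - 1) by field_simp; ring, Real.rpow_add hr, Real.rpow_one]
    have : C ^ (1 / (p - 1)) ≠ 0 := by positivity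
    have : r ^ (1 / (p - 1)) ≠ 0 := by positivity
    field_simp
  calc _ = ENNReal.ofReal r * ENNReal.ofReal ((p - 1) ^ 2 / (p * (p + 1)) * τ₀⁻¹) := by
        rw [ENNReal.ofReal_rpow_of_pos hr, ← ENNReal.ofReal_mul (by positivity),
          ← ENNReal.ofReal_mul hr.le, mul_assoc, hconst]
        ring_nf
    _ = ∫⁻ τ in Set.Ioi τ₀, ENNReal.ofReal r * ENNReal.ofReal
        (τ ^ (-2 : ℝ) * (1 - τ₀ ^ ((p - 1) / 2) * τ ^ ((1 - p) / 2)) ^ 2) := by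
        rw [integral_Ioi_sq_sub_rpow hp hτ₀, lintegral_const_mul' _ _ ENNReal.ofReal_ne_top]
    _ ≤ ∫⁻ τ in Set.Ioi τ₀, ENNReal.ofReal (τ ^ (-2 : ℝ)) *
        (ENNReal.ofReal r ^ (1 / 2 : ℝ) - ENNReal.ofReal (C * τ ^ (1 - p)) ^ (1 / 2 : ℝ)) ^ 2 := by
        refine setLIntegral_mono' measurableSet_Ioi fun τ hτ => ?_
        have hτ' : 0 < τ := hτ₀.trans hτ
        have hle : τ₀ ^ ((p - 1) / 2) * τ ^ ((1 - p) / 2) ≤ 1 := by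
          rw [show (1 - p) / 2 = -((p - 1) / 2) by ring, Real.rpow_neg hτ'.le, ← div_eq_mul_inv]
          exact div_le_one_of_le₀ (Real.rpow_le_rpow hτ₀.le (le_of_lt hτ) (by positivity))
            (by positivity)
        have e1 : (C * τ ^ (1 - p)) ^ (1 / 2 : ℝ) =
            r ^ (1 / 2 : ℝ) * (τ₀ ^ ((p - 1) / 2) * τ ^ ((1 - p) / 2)) := by
          rw [hCr, Real.mul_rpow (by positivity) (by positivity),
            Real.mul_rpow (by positivity) (by positivity), ← Real.rpow_mul hτ₀.le,
            ← Real.rpow_mul hτ'.le]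
          ring_nf
        rw [ENNReal.ofReal_rpow_of_pos hr, ENNReal.ofReal_rpow_of_pos (by positivity),
          ← ENNReal.ofReal_sub _ (by positivity), ← ENNReal.ofReal_pow, e1,
          ← ENNReal.ofReal_mul hr.le, ← ENNReal.ofReal_mul (by positivity)]
        · apply ENNReal.ofReal_le_ofReal
          have e2 : r = (r ^ (1 / 2 : ℝ)) ^ 2 := by
            rw [← Real.rpow_natCast, ← Real.rpow_mul hr.le]; norm_num
          nth_rewrite 1 [e2]
          exact le_of_eq (by ring)
        · rw [e1]
          nlinarith [Real.rpow_pos_of_pos hr (1 / 2)]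
    _ ≤ _ := lintegral_mono_set (Set.Ioi_subset_Ioi hτ₀.le)

end ScalarInequalities

/-! ### Density of the high momenta and the lower bound for the trace. -/

section DensityBound

variable {d : ℕ}

/-- Distribution function of `ξ ↦ a(2πξ)` for `a` in weak `L_p`. -/
theorem volume_superlevel_le {p : ℝ} (hp : 1 < p) {a b : EuclideanSpace ℝ (Fin d) → ℝ}
    (hab : ∀ᵐ ξ, a ((2 * Real.pi) • ξ) = b ξ) (ha_weak : weakLpNorm p a < ∞)
    {s : ℝ} (hs : 0 < s) :
    volume {ξ | s < b ξ} ≤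
      ENNReal.ofReal ((2 * Real.pi) ^ (-(d : ℝ)) * (weakLpNorm p a).toReal ^ p * s ^ (-p)) := by
  have hp0 : 0 < p := by linarith
  have hπ : 0 < 2 * Real.pi := by positivity
  have h1 : ENNReal.ofReal s ^ p * volume {ξ | s < |a ξ|} ≤ weakLpNorm p a ^ p := by
    rw [weakLpNorm, ← ENNReal.rpow_mul, inv_mul_cancel₀ hp0.ne', ENNReal.rpow_one]
    exact le_iSup₂ (f := fun (τ : ℝ) (_ : 0 < τ) =>
      ENNReal.ofReal τ ^ p * volume {ξ | τ < |a ξ|}) s hs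
  have h2 : volume {ξ | s < b ξ} ≤
      volume ((fun ξ => (2 * Real.pi) • ξ) ⁻¹' {ξ | s < |a ξ|}) := by
    refine measure_mono_ae ?_
    filter_upwards [hab] with ξ hξ h
    change s < |a ((2 * Real.pi) • ξ)|
    rw [hξ]
    exact lt_of_lt_of_le h (le_abs_self _)
  rw [Measure.addHaar_preimage_smul volume hπ.ne', finrank_euclideanSpace_fin] at h2
  have h3 : volume {ξ | s < |a ξ|} ≤ ENNReal.ofReal (s ^ (-p)) * weakLpNorm p a ^ p := by
    have h0 : ENNReal.ofReal (s ^ (-p)) * ENNReal.ofReal s ^ p = 1 := by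
      rw [ENNReal.ofReal_rpow_of_pos hs, ← ENNReal.ofReal_mul (by positivity),
        ← Real.rpow_add hs]
      simp
    calc _ = ENNReal.ofReal (s ^ (-p)) * (ENNReal.ofReal s ^ p * volume {ξ | s < |a ξ|}) := by
          rw [← mul_assoc, h0, one_mul]
      _ ≤ _ := by gcongr
  refine (h2.trans (mul_le_mul_right h3 _)).trans (le_of_eq ?_)
  have h4 : weakLpNorm p a ^ p = ENNReal.ofReal ((weakLpNorm p a).toReal ^ p) := by
    rw [← ENNReal.ofReal_rpow_of_nonneg ENNReal.toReal_nonneg hp0.le,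
      ENNReal.ofReal_toReal ha_weak.ne]
  have h5 : |((2 * Real.pi) ^ d)⁻¹| = (2 * Real.pi) ^ (-(d : ℝ)) := by
    rw [abs_of_pos (by positivity), Real.rpow_neg hπ.le, Real.rpow_natCast]
  rw [h4, h5, ← ENNReal.ofReal_mul (by positivity), ← ENNReal.ofReal_mul (by positivity)]
  ring_nf

/-- The final bound contains a negative power of this norm. If the norm vanished, every set `{|a| >
1/(n+1)}` would be null, against `a > 0` a.e. -/
theorem weakLpNorm_pos {p : ℝ} (hp : 1 < p) {a : EuclideanSpace ℝ (Fin d) → ℝ}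
    (ha_pos : ∀ᵐ ξ, 0 < a ξ) : 0 < weakLpNorm p a := by
  have hp0 : 0 < p := by linarith
  rw [pos_iff_ne_zero]
  intro h0
  rw [weakLpNorm, ENNReal.rpow_eq_zero_iff_of_pos (by positivity)] at h0
  simp only [ENNReal.iSup_eq_zero, mul_eq_zero] at h0
  have h1 : ∀ n : ℕ, ∀ᵐ ξ, ¬ (1 / ((n : ℝ) + 1) < |a ξ|) := by
    intro n
    have hn : 0 < 1 / ((n : ℝ) + 1) := by positivity
    rcases h0 _ hn with h | h
    · rw [ENNReal.rpow_eq_zero_iff_of_pos hp0, ENNReal.ofReal_eq_zero] at h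
      exact absurd h (not_le.mpr hn)
    · rw [ae_iff]
      simpa using h
  obtain ⟨ξ, h2, h3⟩ := ((ae_all_iff.mpr h1).and ha_pos).exists
  obtain ⟨n, hn⟩ := exists_nat_one_div_lt h3
  exact h2 n (hn.trans_le (le_abs_self _))

theorem sqForm_fourierMultiplier_of_ae {m b : EuclideanSpace ℝ (Fin d) → ℝ}
    (hm : AEMeasurable m volume) (hmb : ∀ᵐ ξ, m ((2 * Real.pi) • ξ) ^ 2 = b ξ) (f : L2 d) :
    sqForm (fourierMultiplier m) f = ∫⁻ ξ, ENNReal.ofReal (b ξ) * ‖(𝓕 f : L2 d) ξ‖ₑ ^ 2 := by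
  rw [sqForm_fourierMultiplier m hm]
  refine lintegral_congr_ae ?_
  filter_upwards [hmb] with ξ hξ
  rw [← hξ, ← sq_abs, ENNReal.ofReal_pow (abs_nonneg _), Real.enorm_eq_ofReal_abs]

variable {ι : Type*} [Countable ι] {S : L2 d →ₗ.[ℂ] L2 d} {e : HilbertBasis ι ℂ (L2 d)}
  {he : ∀ i, e i ∈ S.domain}

theorem measurable_tsum_enorm_sq (g : ι → L2 d) :
    Measurable fun x => ∑' i, ‖(g i : EuclideanSpace ℝ (Fin d) → ℂ) x‖ₑ ^ 2 :=
  Measurable.tsum fun i => ((Lp.stronglyMeasurable (g i)).measurable.enorm).pow_const 2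

theorem setLIntegral_tsum_enorm_sq (g : ι → L2 d) (Ω : Set (EuclideanSpace ℝ (Fin d))) :
    ∫⁻ x in Ω, ∑' i, ‖(g i : EuclideanSpace ℝ (Fin d) → ℂ) x‖ₑ ^ 2 =
      ∑' i, ∫⁻ x in Ω, ‖(g i : EuclideanSpace ℝ (Fin d) → ℂ) x‖ₑ ^ 2 :=
  lintegral_tsum fun i =>
    (((Lp.stronglyMeasurable (g i)).measurable.enorm).pow_const 2).aemeasurable

theorem lintegral_mul_tsum_enorm_sq {c : EuclideanSpace ℝ (Fin d) → ℝ≥0∞} (hc : Measurable c)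
    (g : ι → L2 d) (μ : Measure (EuclideanSpace ℝ (Fin d))) :
    ∫⁻ x, c x * ∑' i, ‖(g i : EuclideanSpace ℝ (Fin d) → ℂ) x‖ₑ ^ 2 ∂μ =
      ∑' i, ∫⁻ x, c x * ‖(g i : EuclideanSpace ℝ (Fin d) → ℂ) x‖ₑ ^ 2 ∂μ := by
  simp_rw [← ENNReal.tsum_mul_left]
  exact lintegral_tsum fun i =>
    (hc.mul (((Lp.stronglyMeasurable (g i)).measurable.enorm).pow_const 2)).aemeasurable

/-- The density of the part of `S²` with momenta in `{b > τ}`. -/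
theorem tsum_enorm_fourierCutoff_sq_le {p K τ : ℝ} (hp : 1 < p) (hK : 0 ≤ K) (hτ : 0 < τ)
    (hS : ∀ h : L2 d, sqForm S h = ∑' i, ‖inner ℂ (S ⟨e i, he i⟩) h‖ₑ ^ 2)
    {b : EuclideanSpace ℝ (Fin d) → ℝ} (hb : Measurable b)
    (hSb : ∀ f : L2 d, sqForm S f ≤ ∫⁻ ξ, ENNReal.ofReal (b ξ) * ‖(𝓕 f : L2 d) ξ‖ₑ ^ 2)
    (hbK : ∀ s, 0 < s → volume {ξ | s < b ξ} ≤ ENNReal.ofReal (K * s ^ (-p))) :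
    ∀ᵐ x, ∑' i, ‖fourierCutoff {ξ | τ < b ξ} (measurableSet_lt measurable_const hb)
        (S ⟨e i, he i⟩) x‖ₑ ^ 2 ≤ ENNReal.ofReal (K * (p / (p - 1)) * τ ^ (1 - p)) := by
  have hA : MeasurableSet {ξ | τ < b ξ} := measurableSet_lt measurable_const hb
  set A := {ξ | τ < b ξ}
  refine ae_le_of_forall_setLIntegral_le_of_sigmaFinite
    (measurable_tsum_enorm_sq fun i => fourierCutoff A hA (S ⟨e i, he i⟩)) fun Ω hΩ hfin => ?_
  rw [setLIntegral_tsum_enorm_sq fun i => fourierCutoff A hA (S ⟨e i, he i⟩)]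
  simp_rw [← enorm_restrictTo_sq Ω hΩ]
  -- Passing to the adjoint moves `S` to the outside, where the form bound `hSb` applies to the
  -- vectors `P χ_Ω e_j`, with `P` the momentum cutoff to `A`.
  rw [tsum_enorm_apply_sq_eq_tsum_sqForm_adjoint hS
    (fun f => restrictTo Ω hΩ (fourierCutoff A hA f))
    (fun f => fourierCutoff A hA (restrictTo Ω hΩ f))
    (fun x y => by rw [inner_restrictTo, inner_fourierCutoff])]
  calc ∑' j, sqForm S (fourierCutoff A hA (restrictTo Ω hΩ (e j)))
      ≤ ∑' j, ∫⁻ ξ in A, ENNReal.ofReal (b ξ) *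
          ‖(𝓕 (restrictTo Ω hΩ (e j)) : L2 d) ξ‖ₑ ^ 2 := by
        refine ENNReal.tsum_le_tsum fun j => (hSb _).trans (le_of_eq ?_)
        rw [fourier_fourierCutoff, ← lintegral_indicator hA]
        refine lintegral_congr_ae ?_
        filter_upwards [restrictTo_coeFn A hA (𝓕 (restrictTo Ω hΩ (e j)))] with ξ hξ
        rw [hξ]
        by_cases h : ξ ∈ A <;> simp [h]
    _ = ∫⁻ ξ in A, ENNReal.ofReal (b ξ) *
          ∑' j, ‖(𝓕 (restrictTo Ω hΩ (e j)) : L2 d) ξ‖ₑ ^ 2 := by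
        exact (lintegral_mul_tsum_enorm_sq hb.ennreal_ofReal
          (fun j => (𝓕 (restrictTo Ω hΩ (e j)) : L2 d)) (volume.restrict A)).symm
    _ = ∫⁻ ξ in A, ENNReal.ofReal (b ξ) * volume Ω := by
        refine lintegral_congr_ae (ae_restrict_of_ae ?_)
        filter_upwards [tsum_enorm_fourier_restrictTo_sq e Ω hΩ hfin] with ξ hξ
        rw [hξ]
    _ ≤ ENNReal.ofReal (K * (p / (p - 1)) * τ ^ (1 - p)) * volume Ω := by
        rw [lintegral_mul_const' _ _ hfin.ne]
        exact mul_le_mul_left (setLIntegral_superlevel_le hb hp hK hτ hbK) _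
    _ = _ := (setLIntegral_const _ _).symm

/-- Layer-cake formula for the form of `b⁻¹` in momentum space. -/
theorem tsum_lintegral_inv_eq {b : EuclideanSpace ℝ (Fin d) → ℝ} (hb : Measurable b)
    (hb_pos : ∀ᵐ ξ, 0 < b ξ) (g : ι → L2 d) :
    ∑' i, ∫⁻ ξ, ENNReal.ofReal (b ξ)⁻¹ * ‖(𝓕 (g i) : L2 d) ξ‖ₑ ^ 2 =
      ∫⁻ τ in Set.Ioi (0 : ℝ), ENNReal.ofReal (τ ^ (-2 : ℝ)) *
        ∑' i, ‖fourierCutoff {ξ | τ < b ξ}ᶜ (measurableSet_lt measurable_const hb).compl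
          (g i)‖ₑ ^ 2 := by
  have hG := measurable_tsum_enorm_sq fun i => (𝓕 (g i) : L2 d)
  rw [← lintegral_mul_tsum_enorm_sq (c := fun ξ => ENNReal.ofReal (b ξ)⁻¹) hb.inv.ennreal_ofReal
    (fun i => (𝓕 (g i) : L2 d)) volume]
  simp_rw [enorm_fourierCutoff_sq]
  set G := fun ξ => ∑' i, ‖(𝓕 (g i) : L2 d) ξ‖ₑ ^ 2
  have hind : Measurable fun q : EuclideanSpace ℝ (Fin d) × ℝ =>
      (Set.Iic q.2).indicator (1 : ℝ → ℝ≥0∞) (b q.1) := by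
    have : Measurable ({q : EuclideanSpace ℝ (Fin d) × ℝ | b q.1 ≤ q.2}.indicator
        (fun _ => (1 : ℝ≥0∞))) :=
      measurable_const.indicator (measurableSet_le (hb.comp measurable_fst) measurable_snd)
    exact this
  calc ∫⁻ ξ, ENNReal.ofReal (b ξ)⁻¹ * G ξ
      = ∫⁻ ξ, ∫⁻ τ in Set.Ioi (0 : ℝ), ENNReal.ofReal (τ ^ (-2 : ℝ)) *
          (Set.Iic τ).indicator 1 (b ξ) * G ξ := by
        refine lintegral_congr_ae ?_
        filter_upwards [hb_pos] with ξ hξ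
        rw [lintegral_mul_const, lintegral_Ioi_indicator_rpow_neg_two hξ]
        exact (measurable_id.pow_const _).ennreal_ofReal.mul
          (hind.comp (measurable_const.prodMk measurable_id))
    _ = ∫⁻ τ in Set.Ioi (0 : ℝ), ∫⁻ ξ, ENNReal.ofReal (τ ^ (-2 : ℝ)) *
          (Set.Iic τ).indicator 1 (b ξ) * G ξ := by
        refine lintegral_lintegral_swap (Measurable.aemeasurable ?_)
        exact ((measurable_snd.pow_const _).ennreal_ofReal.mul hind).mul (hG.comp measurable_fst)
    _ = _ := by
        refine lintegral_congr fun τ => ?_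
        simp_rw [mul_assoc]
        rw [lintegral_const_mul' _ _ ENNReal.ofReal_ne_top,
          ← setLIntegral_tsum_enorm_sq fun i => (𝓕 (g i) : L2 d),
          ← lintegral_indicator (measurableSet_lt measurable_const hb).compl]
        congr 1
        refine lintegral_congr fun ξ => ?_
        by_cases h : b ξ ≤ τ <;> simp [h, G]

/-- The trace bound for a `γ = S²` whose density is `∑ |S e_i|²`. -/
theorem const_mul_lintegral_density_le {p K : ℝ} (hp : 1 < p) (hK : 0 < K)
    (hS : ∀ h : L2 d, sqForm S h = ∑' i, ‖inner ℂ (S ⟨e i, he i⟩) h‖ₑ ^ 2)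
    {b : EuclideanSpace ℝ (Fin d) → ℝ} (hb : Measurable b) (hb_pos : ∀ᵐ ξ, 0 < b ξ)
    (hSb : ∀ f : L2 d, sqForm S f ≤ ∫⁻ ξ, ENNReal.ofReal (b ξ) * ‖(𝓕 f : L2 d) ξ‖ₑ ^ 2)
    (hbK : ∀ s, 0 < s → volume {ξ | s < b ξ} ≤ ENNReal.ofReal (K * s ^ (-p))) :
    ENNReal.ofReal ((p - 1) ^ 2 / (p * (p + 1)) * (K * (p / (p - 1))) ^ (-(1 / (p - 1)))) *
        ∫⁻ x, (∑' i, ‖S ⟨e i, he i⟩ x‖ₑ ^ 2) ^ (p / (p - 1)) ≤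
      ∑' i, ∫⁻ ξ, ENNReal.ofReal (b ξ)⁻¹ * ‖(𝓕 (S ⟨e i, he i⟩) : L2 d) ξ‖ₑ ^ 2 := by
  have hp1 : 0 < p - 1 := by linarith
  have hρ := measurable_tsum_enorm_sq fun i => S ⟨e i, he i⟩
  set ρ := fun x => ∑' i, ‖S ⟨e i, he i⟩ x‖ₑ ^ 2
  rw [tsum_lintegral_inv_eq hb hb_pos, ← lintegral_const_mul' _ _ ENNReal.ofReal_ne_top]
  calc _ ≤ ∫⁻ x, ∫⁻ τ in Set.Ioi (0 : ℝ), ENNReal.ofReal (τ ^ (-2 : ℝ)) *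
        (ρ x ^ (1 / 2 : ℝ) -
          ENNReal.ofReal (K * (p / (p - 1)) * τ ^ (1 - p)) ^ (1 / 2 : ℝ)) ^ 2 :=
        lintegral_mono fun x => const_mul_rpow_le_lintegral hp (by positivity) (ρ x)
    _ = ∫⁻ τ in Set.Ioi (0 : ℝ), ∫⁻ x, ENNReal.ofReal (τ ^ (-2 : ℝ)) *
        (ρ x ^ (1 / 2 : ℝ) -
          ENNReal.ofReal (K * (p / (p - 1)) * τ ^ (1 - p)) ^ (1 / 2 : ℝ)) ^ 2 := by
        refine lintegral_lintegral_swap (Measurable.aemeasurable ?_)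
        refine (measurable_snd.pow_const _).ennreal_ofReal.mul (Measurable.pow_const ?_ 2)
        exact ((hρ.comp measurable_fst).pow_const _).sub
          (((measurable_snd.pow_const _).const_mul _).ennreal_ofReal.pow_const _)
    _ ≤ _ := by
        -- For fixed `τ` the comparison is pointwise in `x`: the sequence `S e_i (x)` is a high plus
        -- a low momentum part, and the `ℓ²` norm of the high part is at most `√(C τ^{1-p})`.
        -- Countability of `ι` allows one null set for all `i`.
        refine setLIntegral_mono' measurableSet_Ioi fun τ hτ => ?_
        rw [lintegral_const_mul' _ _ ENNReal.ofReal_ne_top]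
        gcongr
        have hA : MeasurableSet {ξ | τ < b ξ} := measurableSet_lt measurable_const hb
        simp_rw [enorm_sq_eq_lintegral]
        have hsum := setLIntegral_tsum_enorm_sq
          (fun i => fourierCutoff {ξ | τ < b ξ}ᶜ hA.compl (S ⟨e i, he i⟩)) Set.univ
        rw [Measure.restrict_univ] at hsum
        rw [← hsum]
        refine lintegral_mono_ae ?_
        have hadd : ∀ᵐ x, ∀ i, (S ⟨e i, he i⟩ : L2 d) x =
            fourierCutoff {ξ | τ < b ξ} hA (S ⟨e i, he i⟩) x +
            fourierCutoff {ξ | τ < b ξ}ᶜ hA.compl (S ⟨e i, he i⟩) x := by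
          rw [ae_all_iff]
          intro i
          have := Lp.coeFn_add (fourierCutoff {ξ | τ < b ξ} hA (S ⟨e i, he i⟩))
            (fourierCutoff {ξ | τ < b ξ}ᶜ hA.compl (S ⟨e i, he i⟩))
          rw [fourierCutoff_add_compl] at this
          exact this
        filter_upwards [hadd, tsum_enorm_fourierCutoff_sq_le hp hK.le hτ hS hb hSb hbK]
          with x h1 h2
        exact sq_sqrt_tsum_sub_le _ _ _ _ (fun i => by rw [h1 i]; exact enorm_add_le _ _) h2

end DensityBound

/-! ### The diagonal, the constant, and the conclusion. -/

/-- The diagonal of `S²` is `∑ |S e_i|²`. -/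
theorem isDiagonal_tsum_enorm_sq {d : ℕ} {γ : L2 d →ₗ.[ℂ] L2 d} {ι : Type*} [Countable ι]
    {e : HilbertBasis ι ℂ (L2 d)} {he : ∀ i, e i ∈ (posSqrt γ).domain}
    (hS : ∀ h : L2 d, sqForm (posSqrt γ) h =
      ∑' i, ‖inner ℂ (posSqrt γ ⟨e i, he i⟩) h‖ₑ ^ 2) :
    IsDiagonal γ fun x => ∑' i, ‖posSqrt γ ⟨e i, he i⟩ x‖ₑ ^ 2 := by
  refine ⟨(measurable_tsum_enorm_sq fun i => posSqrt γ ⟨e i, he i⟩).aemeasurable,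
    fun Ω hΩ _ => ?_⟩
  rw [setLIntegral_tsum_enorm_sq fun i => posSqrt γ ⟨e i, he i⟩,
    formTrace_sqForm_eq_tsum hS (restrictTo Ω hΩ) (restrictTo Ω hΩ) (inner_restrictTo Ω hΩ)]
  simp_rw [enorm_restrictTo_sq]

/-- This transfers the bound from the explicit density to an arbitrary diagonal. -/
theorem IsDiagonal.ae_eq {d : ℕ} {γ : L2 d →ₗ.[ℂ] L2 d}
    {ρ ρ' : EuclideanSpace ℝ (Fin d) → ℝ≥0∞} (h : IsDiagonal γ ρ) (h' : IsDiagonal γ ρ') :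
    ρ =ᵐ[volume] ρ' :=
  ae_eq_of_forall_setLIntegral_eq_of_sigmaFinite₀ h.1 h'.1 fun Ω hΩ hfin => by
    rw [h.2 Ω hΩ hfin, h'.2 Ω hΩ hfin]

/-- The last factor is `C^{-1/(p-1)}` for the constant `C` of the high-momentum bound. One factor
`(p-1)/p` of the semiclassical constant combines with `(p-1)/(p+1)` to the value of the scalar
integral. -/
theorem semiclassicalConst_mul_eq (d : ℕ) {p W : ℝ} (hp : 1 < p) (hW : 0 < W) :
    (p - 1) / (p + 1) * semiclassicalConst d p * W ^ (-(p / (p - 1))) =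
      (p - 1) ^ 2 / (p * (p + 1)) *
        ((2 * Real.pi) ^ (-(d : ℝ)) * W ^ p * (p / (p - 1))) ^ (-(1 / (p - 1))) := by
  have hp1 : 0 < p - 1 := by linarith
  have hp0 : 0 < p := by linarith
  have hπ : 0 < 2 * Real.pi := by positivity
  rw [Real.mul_rpow (by positivity) (by positivity), Real.mul_rpow (by positivity) (by positivity),
    ← Real.rpow_mul hπ.le, ← Real.rpow_mul hW.le, semiclassicalConst]
  have e1 : -(d : ℝ) * -(1 / (p - 1)) = d / (p - 1) := by ring
  have e2 : p * -(1 / (p - 1)) = -(p / (p - 1)) := by ring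
  have e3 : (p / (p - 1)) ^ (-(1 / (p - 1))) = ((p - 1) / p) ^ (1 / (p - 1)) := by
    rw [Real.rpow_neg (by positivity), ← Real.inv_rpow (by positivity), inv_div]
  have e4 : ((p - 1) / p) ^ (p / (p - 1)) = ((p - 1) / p) * ((p - 1) / p) ^ (1 / (p - 1)) := by
    rw [show p / (p - 1) = 1 + 1 / (p - 1) by field_simp; ring,
      Real.rpow_add (by positivity), Real.rpow_one]
  rw [e1, e2, e3, e4]
  field_simp

theorem mainTheorem5 (d : ℕ) (p : ℝ) (hp : 1 < p)
    (a : EuclideanSpace ℝ (Fin d) → ℝ) (ha : AEMeasurable a volume)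
    (ha_pos : ∀ᵐ ξ, 0 < a ξ) (ha_weak : weakLpNorm p a < ∞)
    (γ : L2 d →ₗ.[ℂ] L2 d) (hγ : IsPosSelfAdjoint γ) (hγa : FormLEMultiplier γ a) :
    (traceInv a γ < ∞ →
      ∃ ρ : EuclideanSpace ℝ (Fin d) → ℝ≥0∞, IsDiagonal γ ρ ∧ (∀ᵐ x, ρ x < ∞) ∧
        ∫⁻ x, ρ x ^ (p / (p - 1)) < ∞) ∧
    (∀ ρ : EuclideanSpace ℝ (Fin d) → ℝ≥0∞, IsDiagonal γ ρ →
      ENNReal.ofReal ((p - 1) / (p + 1) * semiclassicalConst d p) *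
          weakLpNorm p a ^ (-(p / (p - 1))) * ∫⁻ x, ρ x ^ (p / (p - 1)) ≤
        traceInv a γ) := by
  have hp1 : 0 < p - 1 := by linarith
  have hp0 : 0 < p := by linarith
  have : SecondCountableTopology (L2 d) := by
    have : Fact ((2 : ℝ≥0∞) ≠ ∞) := ⟨by norm_num⟩
    infer_instance
  obtain ⟨ι, _, e, he, hS⟩ := exists_hilbertBasis_sqForm_eq hγ.isPosSqrt_posSqrt.1.1
  have hdiag := isDiagonal_tsum_enorm_sq hS
  set ρ₀ : EuclideanSpace ℝ (Fin d) → ℝ≥0∞ := fun x => ∑' i, ‖posSqrt γ ⟨e i, he i⟩ x‖ₑ ^ 2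
  have hW : 0 < (weakLpNorm p a).toReal :=
    ENNReal.toReal_pos (weakLpNorm_pos hp ha_pos).ne' ha_weak.ne
  set W := (weakLpNorm p a).toReal
  have hWeq : weakLpNorm p a = ENNReal.ofReal W := (ENNReal.ofReal_toReal ha_weak.ne).symm
  -- A Borel representative of `a`, rescaled by `2π` to match the kernel `exp(-2πi x·ξ)` of `𝓕`; the
  -- scaling produces the factor `(2π)^{-d}`.
  let b : EuclideanSpace ℝ (Fin d) → ℝ := fun ξ => ha.mk a ((2 * Real.pi) • ξ)
  have hb : Measurable b := ha.measurable_mk.comp (measurable_const_smul _)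
  have hab : ∀ᵐ ξ, a ((2 * Real.pi) • ξ) = b ξ :=
    quasiMeasurePreserving_two_pi_smul.ae ha.ae_eq_mk
  have hb_pos : ∀ᵐ ξ, 0 < b ξ := by
    filter_upwards [hab, quasiMeasurePreserving_two_pi_smul.ae ha_pos] with ξ h1 h2
    rwa [← h1]
  have hSb : ∀ f : L2 d, sqForm (posSqrt γ) f ≤
      ∫⁻ ξ, ENNReal.ofReal (b ξ) * ‖(𝓕 f : L2 d) ξ‖ₑ ^ 2 := by
    intro f
    refine (hγa f).trans (le_of_eq (sqForm_fourierMultiplier_of_ae ha.sqrt ?_ f))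
    filter_upwards [hab, hb_pos] with ξ h1 h2
    rw [h1, Real.sq_sqrt h2.le]
  have hinv : ∀ f : L2 d, sqForm (fourierMultiplier fun ξ => (√(a ξ))⁻¹) f =
      ∫⁻ ξ, ENNReal.ofReal (b ξ)⁻¹ * ‖(𝓕 f : L2 d) ξ‖ₑ ^ 2 := by
    intro f
    refine sqForm_fourierMultiplier_of_ae (m := fun ξ => (√(a ξ))⁻¹) ha.sqrt.inv ?_ f
    filter_upwards [hab, hb_pos] with ξ h1 h2
    rw [h1, inv_pow, Real.sq_sqrt h2.le]
  have hmain : ENNReal.ofReal ((p - 1) / (p + 1) * semiclassicalConst d p) *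
      weakLpNorm p a ^ (-(p / (p - 1))) * ∫⁻ x, ρ₀ x ^ (p / (p - 1)) ≤ traceInv a γ := by
    have hsc : 0 ≤ semiclassicalConst d p := by rw [semiclassicalConst]; positivity
    rw [hWeq, ENNReal.ofReal_rpow_of_pos hW, ← ENNReal.ofReal_mul (by positivity),
      semiclassicalConst_mul_eq d hp hW]
    refine (const_mul_lintegral_density_le hp (by positivity) hS hb hb_pos hSb
      fun s hs => volume_superlevel_le hp hab ha_weak hs).trans ?_
    simp_rw [← hinv]
    exact tsum_le_formTrace
      (fun f => sqForm (fourierMultiplier fun ξ => (√(a ξ))⁻¹) (posSqrt γ f)) e.orthonormal he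
  refine ⟨fun htr => ⟨ρ₀, hdiag, ?_⟩, fun ρ hρ => ?_⟩
  · have hfin : ∫⁻ x, ρ₀ x ^ (p / (p - 1)) < ∞ := by
      by_contra h
      -- The prefactor is strictly positive, so an infinite integral would force an infinite trace.
      rw [not_lt, top_le_iff] at h
      rw [h, ENNReal.mul_top] at hmain
      · exact htr.not_ge hmain
      · have hsc : 0 < semiclassicalConst d p := by rw [semiclassicalConst]; positivity
        refine mul_ne_zero (ENNReal.ofReal_pos.mpr (by positivity)).ne' ?_
        rw [hWeq, ENNReal.ofReal_rpow_of_pos hW]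
        exact (ENNReal.ofReal_pos.mpr (by positivity)).ne'
    refine ⟨?_, hfin⟩
    filter_upwards [ae_lt_top' (hdiag.1.pow_const _) hfin.ne] with x hx
    rwa [ENNReal.rpow_lt_top_iff_of_pos (by positivity)] at hx
  · refine le_trans (le_of_eq ?_) hmain
    congr 1
    refine lintegral_congr_ae ?_
    filter_upwards [hρ.ae_eq hdiag] with x hx
    rw [hx]

end
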